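/- Let $(S,\mathfrak n)$ be an $F$-finite regular local ring of prime characteristic $p>0$ and let $R=S/J$ be a nonzero quotient ring, with maximal ideal $\mathfrak m$. Conventions, for an $F$-finite local ring $(A,\mathfrak m_A,k)$ of characteristic $p$. Put $\alpha(A)=\log_p[k:k^p]$ and $\mathcal C^A_e=\operatorname{Hom}_A(F^e_*A,A)$. A Cartier subalgebra $\mathcal D=\bigoplus_{e\ge0}\mathcal D_e$ on $A$ is a graded subring (under composition) of $\mathcal C^A=\bigoplus_{e\ge 0}\mathcal C^A_e$ with $\mathcal D_0=\mathcal C^A_0=A$ and $\mathcal D_e\ne0$ for some $e>0$. For $e>0$, $a_e(A,\mathcal D)$ is the maximal number of summands $M_j\cong A$ in a direct sum decomposition $F^e_*A=\bigoplus_i M_i$ whose projection $F^e_*A\to M_j\cong A$ lies in $\mathcal D_e$, and $\Gamma_{\mathcal D}=\{e : a_e(A,\mathcal D)\neq0\}$. Put $P_{\mathcal D}=\{r\in A : \phi(F^e_*r)\in\mathfrak m_A \text{ for all } e>0,\ \phi\in\mathcal D_e\}$. The pair $(A,\mathcal D)$ is $F$-pure if some $\phi\in\mathcal D_e$ with $e>0$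 is surjective; in that case its splitting dimension is $\operatorname{sdim}(A,\mathcal D)=\dim(A/P_{\mathcal D})$, and its splitting ratio is $$r_F(A,\mathcal D)=\lim_{e\in\Gamma_{\mathcal D},\,e\to\infty} \frac{a_e(A,\mathcal D)}{p^{e(\dim(A/P_{\mathcal D})+\alpha(A))}}.$$ An $F$-graded system on $S$ is a sequence of ideals $\mathfrak b_\bullet=(\mathfrak b_e)_{e\ge0}$ of $S$ with $\mathfrak b_0=S$, $\mathfrak b_e\neq0$ for some $e>0$, and $\mathfrak b_e^{[p^l]}\mathfrak b_l\subseteq\mathfrak b_{e+l}$ for all $e,l\ge 0$; it defines the graded subring $\mathcal C^{\mathfrak b_\bullet}$ of $\mathcal C^S$ with $\mathcal C^{\mathfrak b_\bullet}_e=\mathcal C^S_e\cdot F^e_*\mathfrak b_e$, and the invariants of $(S,\mathfrak b_\bullet)$ are those of $(S,\mathcal C^{\mathfrak b_\bullet})$. Theorem. For every Cartier subalgebra $\mathcal D$ on $R$ there is an $F$-graded system $\mathfrak b_\bullet$ on $S$ such that $\mathcal C^{\mathfrak b_\bullet}$ is a Cartier subalgebra on $S$ that induces $\mathcal D$ (for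 every $e\ge 0$, a map $\psi\in\mathcal C^R_e$ lies in $\mathcal D_e$ if and only if it is induced by some $\phi\in\mathcal C^{\mathfrak b_\bullet}_e$), and for all $e>0$ one has $\mathfrak b_e\subseteq(J^{[p^e]}:J)$ and $$\frac{a_e(R,\mathcal D)}{p^{e\alpha(R)}}=\frac{a_e(S,\mathfrak b_\bullet)}{p^{e\alpha(S)}}=\ell_S\big(S/(\mathfrak n^{[p^e]}:\mathfrak b_e)\big)=\ell_S\big(\mathfrak b_e/(\mathfrak b_e\cap\mathfrak n^{[p^e]})\big),$$ all of these numbers being finite. In addition, $$P_{\mathcal D}=P_{\mathfrak b_\bullet}\cdot R=\Big(\bigcap_{e>0}(\mathfrak n^{[p^e]}:\mathfrak b_e)\Big)\cdot R,\qquad P_{\mathfrak b_\bullet}=\bigcap_{e>0}(\mathfrak n^{[p^e]}:\mathfrak b_e).$$ Moreover $(R,\mathcal D)$ is $F$-pure if and only if $(S,\mathfrak b_\bullet)$ is, and in that case $\operatorname{sdim}(R,\mathcal D)=\operatorname{sdim}(S,\mathfrak b_\bullet)$ and $r_F(R,\mathcal D)=r_F(S,\mathfrak b_\bullet)$, the last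 equality meaning that a value is the limit defining one side if and only if it is the limit defining the other. -/

import Mathlib

open IsLocalRing Filter Topology
open scoped ENNReal

/-- A nonzero quotient of a local ring is local. -/
instance quotientIsLocalRing {S : Type*} [CommRing S] [IsLocalRing S] (J : Ideal S)
    [Nontrivial (S ⧸ J)] : IsLocalRing (S ⧸ J) :=
  IsLocalRing.of_surjective' (Ideal.Quotient.mk J) Ideal.Quotient.mk_surjective

/-- A nonzero quotient of a ring of prime characteristic `p` has characteristic `p`. -/
instance quotientCharP {S : Type*} [CommRing S] (p : ℕ) [hp : Fact p.Prime] [CharP S p]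
    (J : Ideal S) [Nontrivial (S ⧸ J)] : CharP (S ⧸ J) p :=
  (CharP.charP_iff_prime_eq_zero hp.out).2 (by
    rw [← map_natCast (Ideal.Quotient.mk J), CharP.cast_eq_zero, map_zero])

/-- The residue field of a local ring of prime characteristic `p` has characteristic `p`. -/
instance residueFieldCharP {R : Type*} [CommRing R] [IsLocalRing R] (p : ℕ) [hp : Fact p.Prime]
    [CharP R p] : CharP (ResidueField R) p :=
  (CharP.charP_iff_prime_eq_zero hp.out).2 (by
    rw [← map_natCast (residue R), CharP.cast_eq_zero, map_zero])

/-- The underlying additive group of `F^e_* R`; it is a copy of `R`. -/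
def FPush (_p _e : ℕ) (R : Type*) : Type _ := R

namespace FPush

variable {p e : ℕ} {R : Type*} [CommRing R]

instance : AddCommGroup (FPush p e R) := inferInstanceAs (AddCommGroup R)

/-- The element `F^e_* r` of `F^e_* R`. -/
def of (p e : ℕ) {R : Type*} [CommRing R] : R ≃+ FPush p e R := AddEquiv.refl R

/-- `F^e_* R` is an `R`-module by restriction of scalars along the `e`-th iterate of Frobenius. -/
noncomputable instance [Fact p.Prime] [CharP R p] : Module R (FPush p e R) :=
  Module.compHom R (iterateFrobenius R p e)

/-- `r • F^e_* x = F^e_* (r ^ (p ^ e) * x)`. -/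
theorem smul_of [Fact p.Prime] [CharP R p] (r x : R) :
    r • of p e x = of p e (r ^ p ^ e * x) := rfl

end FPush

/-- `C^R_e = Hom_R(F^e_* R, R)`, the `p^{-e}`-linear maps on `R`. -/
abbrev CartierMap (p e : ℕ) (R : Type*) [CommRing R] [Fact p.Prime] [CharP R p] : Type _ :=
  FPush p e R →ₗ[R] R

namespace CartierMap

variable {p e f : ℕ} {R : Type*} [CommRing R] [Fact p.Prime] [CharP R p]

/-- The product `φ · ψ = φ ∘ F^e_* ψ` of the Cartier algebra; as an additive map on `R` it is
the composition of `φ` and `ψ`. -/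
noncomputable def mul (φ : CartierMap p e R) (ψ : CartierMap p f R) : CartierMap p (e + f) R where
  toFun x := φ (FPush.of p e (ψ (FPush.of p f ((FPush.of p (e + f)).symm x))))
  map_add' x y := by simp only [map_add]
  map_smul' r x := by
    obtain ⟨x, rfl⟩ := (FPush.of p (e + f)).surjective x
    rw [FPush.smul_of, AddEquiv.symm_apply_apply, AddEquiv.symm_apply_apply, pow_add, pow_mul,
      ← FPush.smul_of, map_smul, smul_eq_mul, ← FPush.smul_of, map_smul, RingHom.id_apply]

theorem mul_of (φ : CartierMap p e R) (ψ : CartierMap p f R) (x : R) :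
    φ.mul ψ (FPush.of p (e + f) x) = φ (FPush.of p e (ψ (FPush.of p f x))) := rfl

/-- The map `φ(F^e_* b · _)`. -/
noncomputable def premul (φ : CartierMap p e R) (b : R) : CartierMap p e R where
  toFun x := φ (FPush.of p e (b * (FPush.of p e).symm x))
  map_add' x y := by simp only [map_add, mul_add]
  map_smul' r x := by
    obtain ⟨x, rfl⟩ := (FPush.of p e).surjective x
    rw [FPush.smul_of, AddEquiv.symm_apply_apply, AddEquiv.symm_apply_apply, mul_left_comm,
      ← FPush.smul_of, map_smul, RingHom.id_apply]

theorem premul_of (φ : CartierMap p e R) (b x : R) :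
    φ.premul b (FPush.of p e x) = φ (FPush.of p e (b * x)) := rfl

end CartierMap

/-- A graded subring `D = ⊕ D_e` of the Cartier algebra `C^R = ⊕ Hom_R(F^e_* R, R)` with
`D_0 = C_0 = Hom_R(R, R)`, given by its homogeneous pieces. (Each piece is then automatically an
`R`-submodule, and `D` is automatically an algebra over the prime field.) -/
structure GradedCartierSubring (p : ℕ) (R : Type*) [CommRing R] [Fact p.Prime] [CharP R p] where
  /-- the homogeneous piece `D_e` -/
  deg : (e : ℕ) → Submodule R (CartierMap p e R)
  deg_zero : deg 0 = ⊤
  mul_mem : ∀ {e f : ℕ} {φ : CartierMap p e R} {ψ : CartierMap p f R},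
    φ ∈ deg e → ψ ∈ deg f → φ.mul ψ ∈ deg (e + f)

/-- A Cartier subalgebra on `R`: additionally `D_e ≠ 0` for some `e > 0`. -/
structure CartierSubalgebra (p : ℕ) (R : Type*) [CommRing R] [Fact p.Prime] [CharP R p] extends
    GradedCartierSubring p R where
  exists_ne_bot : ∃ e, 0 < e ∧ deg e ≠ ⊥

/-- `R` is `F`-finite: `F_* R` is a finitely generated `R`-module. -/
def IsFFinite (p : ℕ) (R : Type*) [CommRing R] [Fact p.Prime] [CharP R p] : Prop :=
  Module.Finite R (FPush p 1 R)

/-- `α(R) = log_p [k : k^p]`, where `k` is the residue field of `R`. -/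
noncomputable def frobAlpha (p : ℕ) (R : Type*) [CommRing R] [IsLocalRing R] [Fact p.Prime]
    [CharP R p] : ℝ :=
  Real.logb p (Module.finrank (frobenius (ResidueField R) p).fieldRange (ResidueField R))

namespace GradedCartierSubring

variable {p : ℕ} {R : Type*} [CommRing R] [Fact p.Prime] [CharP R p]

theorem premul_mem (D : GradedCartierSubring p R) {e : ℕ} {φ : CartierMap p e R}
    (h : φ ∈ D.deg e) (r : R) : φ.premul r ∈ D.deg e := by
  let ψ : CartierMap p 0 R :=
    { toFun := fun x => r * (FPush.of p 0).symm x
      map_add' := fun x y => by simp only [map_add, mul_add]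
      map_smul' := fun s x => by
        obtain ⟨x, rfl⟩ := (FPush.of p 0).surjective x
        rw [FPush.smul_of, AddEquiv.symm_apply_apply, AddEquiv.symm_apply_apply, pow_zero,
          pow_one, mul_left_comm, RingHom.id_apply, smul_eq_mul] }
  have hψ : ψ ∈ D.deg 0 := by rw [D.deg_zero]; exact Submodule.mem_top
  exact D.mul_mem h hψ

/-- In the internal direct sum decomposition `F^e_* R = ⊕ M_i`, the summand `M_j` is a
`D`-summand: there is an isomorphism `θ : M_j ≃ R` such that the projection onto `M_j` followed
by `θ`, i.e. the map that is `θ` on `M_j` and `0` on all other summands, belongs to `D_e`. -/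
def IsDSummand (D : GradedCartierSubring p R) (e : ℕ) {m : ℕ}
    (M : Fin m → Submodule R (FPush p e R)) (j : Fin m) : Prop :=
  ∃ θ : M j ≃ₗ[R] R, ∃ φ ∈ D.deg e,
    (∀ x : M j, φ x = θ x) ∧ ∀ i, i ≠ j → ∀ x ∈ M i, φ x = 0

/-- The `e`-th `F`-splitting number of `(R, D)`: the maximal number of `D`-summands in the direct
sum decompositions of `F^e_* R`. (The supremum is taken in `ℕ∞`.) -/
noncomputable def splittingNumber (D : GradedCartierSubring p R) (e : ℕ) : ℕ∞ :=
  sSup {n : ℕ∞ | ∃ (m : ℕ) (M : Fin m → Submodule R (FPush p e R)) (s : Finset (Fin m)),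
    DirectSum.IsInternal M ∧ (∀ j ∈ s, D.IsDSummand e M j) ∧ n = s.card}

/-- `(R, D)` is `F`-pure: some `φ ∈ D_e` with `e > 0` is surjective. -/
def IsFPure (D : GradedCartierSubring p R) : Prop :=
  ∃ e, 0 < e ∧ ∃ φ ∈ D.deg e, Function.Surjective φ

/-- The ideal `P_D` of all `r` with `φ(F^e_* r) ∈ m` for all `e > 0` and all `φ ∈ D_e`. -/
def splittingPrime [IsLocalRing R] (D : GradedCartierSubring p R) : Ideal R where
  carrier := {r | ∀ e, 0 < e → ∀ φ ∈ D.deg e, φ (FPush.of p e r) ∈ maximalIdeal R}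
  zero_mem' := fun e _ φ _ => by rw [map_zero, map_zero]; exact Ideal.zero_mem _
  add_mem' := fun {a b} ha hb e he φ hφ => by
    rw [map_add, map_add]; exact Ideal.add_mem _ (ha e he φ hφ) (hb e he φ hφ)
  smul_mem' := fun c x hx e he φ hφ => hx e he (φ.premul c) (D.premul_mem hφ c)

/-- The `F`-splitting dimension `dim(R / P_D)` (meant for `F`-pure `(R, D)`). -/
noncomputable def splittingDim [IsLocalRing R] (D : GradedCartierSubring p R) : WithBot ℕ∞ :=
  ringKrullDim (R ⧸ D.splittingPrime)

/-- The semigroup of `D`: the set of all `e` with nonzero splitting number. -/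
def semigroup (D : GradedCartierSubring p R) : Set ℕ := {e | D.splittingNumber e ≠ 0}

/-- `r` is the `F`-splitting ratio of `(R, D)`: with `d = dim(R / P_D)`, it is the limit of
`a_e / p^{e (d + α(R))}` as `e → ∞` in the semigroup of `D`. -/
def IsSplittingRatio [IsLocalRing R] (D : GradedCartierSubring p R) (r : ℝ≥0∞) : Prop :=
  ∃ d : ℕ, D.splittingDim = d ∧
    Tendsto (fun e : ℕ => (D.splittingNumber e : ℝ≥0∞) /
        (p : ℝ≥0∞) ^ ((e : ℝ) * ((d : ℝ) + frobAlpha p R)))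
      (atTop ⊓ 𝓟 D.semigroup) (𝓝 r)

end GradedCartierSubring

/-- The Frobenius power `I^[p^e]`, generated by the `p^e`-th powers of the elements of `I`. -/
noncomputable def frobPower (p : ℕ) {S : Type*} [CommRing S] [Fact p.Prime] [CharP S p]
    (I : Ideal S) (e : ℕ) : Ideal S :=
  I.map (iterateFrobenius S p e)

/-- An `F`-graded system of ideals of `S`. -/
structure FGradedSystem (p : ℕ) (S : Type*) [CommRing S] [Fact p.Prime] [CharP S p] where
  /-- the ideal `b_e` -/
  ideal : ℕ → Ideal S
  ideal_zero : ideal 0 = ⊤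
  exists_ne_bot : ∃ e, 0 < e ∧ ideal e ≠ ⊥
  mul_le : ∀ e l : ℕ, frobPower p (ideal e) l * ideal l ≤ ideal (e + l)

namespace FGradedSystem

variable {p : ℕ} {S : Type*} [CommRing S] [Fact p.Prime] [CharP S p]

/-- `C^S_e · F^e_* b`: all finite sums of maps `φ(F^e_* b · _)` with `φ ∈ C^S_e`, `b ∈ b_e`. -/
noncomputable def cartierDeg (b : FGradedSystem p S) (e : ℕ) : Submodule S (CartierMap p e S) :=
  Submodule.span S {ψ | ∃ φ : CartierMap p e S, ∃ c ∈ b.ideal e, ψ = φ.premul c}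

/-- The graded Cartier algebra `C^b = ⊕ C^S_e · F^e_* b_e` on `S` defined by `b`. -/
noncomputable def cartier (b : FGradedSystem p S) : GradedCartierSubring p S where
  deg := b.cartierDeg
  deg_zero := by
    rw [eq_top_iff]
    intro φ _
    refine Submodule.subset_span ⟨φ, 1, by rw [b.ideal_zero]; exact Submodule.mem_top, ?_⟩
    ext x
    obtain ⟨x, rfl⟩ := (FPush.of p 0).surjective x
    rw [CartierMap.premul_of, one_mul]
  mul_mem := by
    intro e f φ ψ hφ hψ
    have add_left : ∀ (φ₁ φ₂ : CartierMap p e S) (ψ : CartierMap p f S),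
        (φ₁ + φ₂).mul ψ = φ₁.mul ψ + φ₂.mul ψ := fun _ _ _ => rfl
    have smul_left : ∀ (c : S) (φ : CartierMap p e S) (ψ : CartierMap p f S),
        (c • φ).mul ψ = c • φ.mul ψ := fun _ _ _ => rfl
    have add_right : ∀ (φ : CartierMap p e S) (ψ₁ ψ₂ : CartierMap p f S),
        φ.mul (ψ₁ + ψ₂) = φ.mul ψ₁ + φ.mul ψ₂ := by
      intro φ ψ₁ ψ₂
      ext x
      obtain ⟨x, rfl⟩ := (FPush.of p (e + f)).surjective x
      simp only [LinearMap.add_apply, CartierMap.mul_of, map_add]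
    -- a product of generators, the second one multiplied by a scalar
    have key : ∀ (φ : CartierMap p e S) (ψ : CartierMap p f S) (a c : S), a ∈ b.ideal e →
        c ∈ b.ideal f → ∀ t : S, (φ.premul a).mul (t • ψ.premul c) ∈ b.cartierDeg (e + f) := by
      intro φ ψ a c ha hc t
      refine Submodule.subset_span ⟨φ.mul (t • ψ), a ^ p ^ f * c, ?_, ?_⟩
      · exact b.mul_le e f (Ideal.mul_mem_mul
          (Ideal.mem_map_of_mem (iterateFrobenius S p f) ha) hc)
      · ext x
        obtain ⟨x, rfl⟩ := (FPush.of p (e + f)).surjective x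
        have h : ψ (FPush.of p f (a ^ p ^ f * (c * x))) = a * ψ (FPush.of p f (c * x)) := by
          rw [← FPush.smul_of, map_smul, smul_eq_mul]
        rw [CartierMap.mul_of, CartierMap.premul_of, CartierMap.premul_of, CartierMap.mul_of,
          LinearMap.smul_apply, LinearMap.smul_apply, CartierMap.premul_of, mul_assoc, h,
          smul_eq_mul, smul_eq_mul, mul_left_comm]
    induction hφ using Submodule.span_induction with
    | mem φ hφ =>
      obtain ⟨φ, a, ha, rfl⟩ := hφ
      induction hψ using Submodule.closure_induction with
      | zero =>
        have : (φ.premul a).mul (0 : CartierMap p f S) = 0 := by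
          have h := add_right (φ.premul a) 0 0
          rwa [add_zero, left_eq_add] at h
        rw [this]; exact Submodule.zero_mem _
      | add ψ₁ ψ₂ _ _ h₁ h₂ => rw [add_right]; exact Submodule.add_mem _ h₁ h₂
      | smul_mem t ψ hψ =>
        obtain ⟨ψ, c, hc, rfl⟩ := hψ
        exact key φ ψ a c ha hc t
    | zero => exact Submodule.zero_mem _
    | add φ₁ φ₂ _ _ h₁ h₂ => rw [add_left]; exact Submodule.add_mem _ h₁ h₂
    | smul t φ _ h => rw [smul_left]; exact Submodule.smul_mem _ t h

end FGradedSystem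

/-! Write n for the maximal ideal of `S` and k for its residue field. Since `S` is regular and
F-finite, `F^e_* S` is finite free over `S`, and the socle of `S/n^[p^e]` is generated by one
element. A map Φ not sending that element into n makes the form Φ(F^e_*(ab)) nondegenerate modulo n,
hence unimodular; so every p^{-e}-linear map on `S` is Φ(F^e_* c · _) for some c
(`FPush.exists_nondegenerate`, `FPush.exists_eq_premul`).

Let b_e consist of all s such that every φ(F^e_* s · _) descends to an element of D_e (`liftIdeal`).
By freeness each element of D_e lifts to `S`; the lift has the form Φ(F^e_* c · _), and then c lies
in b_e, so C^b_e maps onto D_e. Freeness also gives C_{e+l} = C_e · C_l, which yields the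
multiplicativity of an F-graded system.

A splitting number is the largest size of a system of maps φ_i in D_e and elements m_j with
φ_i(F^e_* m_j) = δ_ij modulo the maximal ideal. Such systems, the ideal P_D and F-purity depend only
on values modulo the maximal ideal, so they pass between `S ⧸ J` and `S`. On `S` these systems are
dual systems for the k-valued pairing (c, x) ↦ Φ(F^e_*(cx)) on b_e × S, with kernels b_e ∩ n^[p^e]
and (n^[p^e] : b_e). The quotient by either kernel, viewed as an `S`-module through F^e, has the
splitting number as its length (`sSup_hasDualPair_eq_length`). Restriction of scalars along F^e
multiplies lengths by [k : k^p]^e = p^{eα}, which gives the stated formulas. -/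

/-! ### Regular local rings: domains with a regular system of parameters -/

section RegularLocal

open RingTheory.Sequence Pointwise

universe u

/-- Dividing a local ring by an element of `m` outside `m ^ 2` lowers the embedding dimension. -/
theorem spanFinrank_maximalIdeal_quotient_lt {S : Type u} [CommRing S] [IsLocalRing S]
    [IsNoetherianRing S] {x : S} (hx : x ∈ maximalIdeal S) (hx2 : x ∉ maximalIdeal S ^ 2)
    [IsLocalRing (S ⧸ Ideal.span {x})] :
    (maximalIdeal (S ⧸ Ideal.span {x})).spanFinrank + 1 ≤ (maximalIdeal S).spanFinrank := by
  classical
  obtain ⟨t, ht, hspan⟩ := Submodule.FG.exists_span_finset_card_eq_spanFinrank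
    (IsNoetherian.noetherian (maximalIdeal S))
  have hxt : x ∈ Submodule.span S (t : Set S) := by rw [hspan]; exact hx
  obtain ⟨a, -, ha⟩ := Submodule.mem_span_finset.1 hxt
  have htm : ∀ y ∈ t, y ∈ maximalIdeal S := fun y hy => by
    rw [← hspan]; exact Submodule.subset_span hy
  -- If every coefficient were in m, then x would be in m². A generator with unit coefficient
  -- becomes redundant modulo x.
  obtain ⟨y, hy, hay⟩ : ∃ y ∈ t, IsUnit (a y) := by
    by_contra! h
    refine hx2 ?_
    rw [← ha, pow_two]
    exact Ideal.sum_mem _ fun y hy => Ideal.mul_mem_mul ((mem_maximalIdeal _).2 (h y hy)) (htm y hy)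
  set π := Ideal.Quotient.mk (Ideal.span {x})
  have hm : maximalIdeal (S ⧸ Ideal.span {x}) = (maximalIdeal S).map π :=
    (map_maximalIdeal_of_surjective π Ideal.Quotient.mk_surjective).symm
  have hle : maximalIdeal (S ⧸ Ideal.span {x}) ≤
      Submodule.span _ (((t.erase y).image π : Finset _) : Set (S ⧸ Ideal.span {x})) := by
    rw [hm, ← hspan, Submodule.span, Ideal.map_le_iff_le_comap]
    change Ideal.span (t : Set S) ≤ _
    rw [Ideal.span_le]
    intro z hz
    by_cases hzy : z = y
    · subst hzy
      have h0 : π x = 0 := Ideal.Quotient.eq_zero_iff_mem.2 (Ideal.mem_span_singleton_self x)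
      have h0 : π (∑ w ∈ t, a w • w) = 0 := (congrArg π ha).trans h0
      rw [← Finset.add_sum_erase _ _ hz, map_add, smul_eq_mul, map_mul] at h0
      have hu : IsUnit (π (a z)) := hay.map π
      change π z ∈ Ideal.span _
      rw [← Ideal.unit_mul_mem_iff_mem _ hu, eq_neg_of_add_eq_zero_left h0, map_sum]
      refine neg_mem (Ideal.sum_mem _ fun w hw => ?_)
      rw [smul_eq_mul, map_mul]
      exact Ideal.mul_mem_left _ _
        (Ideal.subset_span (Finset.mem_coe.2 (Finset.mem_image_of_mem π hw)))
    · exact Ideal.subset_span (by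
        simpa using ⟨z, ⟨hz, hzy⟩, rfl⟩)
  have heq : maximalIdeal (S ⧸ Ideal.span {x}) =
      Submodule.span _ (((t.erase y).image π : Finset _) : Set (S ⧸ Ideal.span {x})) := by
    refine le_antisymm hle (Submodule.span_le.2 ?_)
    intro z hz
    obtain ⟨w, hw, rfl⟩ := Finset.mem_image.1 (Finset.mem_coe.1 hz)
    rw [hm]
    exact Ideal.mem_map_of_mem _ (htm w (Finset.mem_of_mem_erase hw))
  rw [heq, ← ht, ← Finset.card_erase_add_one hy]
  refine Nat.succ_le_succ ((Submodule.spanFinrank_span_le_ncard_of_finite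
    (Finset.finite_toSet _)).trans ?_)
  rw [Set.ncard_coe_finset]
  exact Finset.card_image_le

/-- Induction on the embedding dimension. For x in m outside m² and outside all minimal primes, the
quotient by x is again regular, so it is a domain by induction and (x) is prime. The domain property
of `S` makes x regular, and the sequence found for the quotient is lifted and appended to x. -/
theorem IsRegularLocalRing.isDomain_and_exists_isWeaklyRegular_aux (n : ℕ) :
    ∀ (S : Type u) [CommRing S] [IsRegularLocalRing S], (maximalIdeal S).spanFinrank = n →
      IsDomain S ∧ ∃ xs : List S, Ideal.ofList xs = maximalIdeal S ∧ IsWeaklyRegular S xs := by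
  induction n using Nat.strong_induction_on with
  | _ n ih =>
  intro S _ _ hn
  have hfg : (maximalIdeal S).FG := IsNoetherian.noetherian _
  by_cases hbot : maximalIdeal S = ⊥
  · have hf := (isField_iff_maximalIdeal_eq (R := S)).2 hbot
    exact ⟨hf.isDomain, [], by rw [Ideal.ofList_nil, hbot], IsWeaklyRegular.nil S S⟩
  have hdim : ((maximalIdeal S).spanFinrank : WithBot ℕ∞) = ringKrullDim S :=
    (isRegularLocalRing_iff S).1 inferInstance
  have hfin : (minimalPrimes S).Finite := minimalPrimes.finite_of_isNoetherianRing S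
  -- Prime avoidance, which tolerates the non-prime ideal m². If m ⊆ m², Nakayama gives m = 0; if m
  -- is a minimal prime, the dimension is 0, so regularity again gives m = 0.
  obtain ⟨x, hxm, hx2, hxp⟩ : ∃ x ∈ maximalIdeal S, x ∉ maximalIdeal S ^ 2 ∧
      ∀ P ∈ minimalPrimes S, x ∉ P := by
    by_contra! h
    have hsub : (maximalIdeal S : Set S) ⊆
        ⋃ I ∈ insert (maximalIdeal S ^ 2) (minimalPrimes S), (I : Set S) := by
      intro x hx
      by_cases hx2 : x ∈ maximalIdeal S ^ 2
      · exact Set.mem_biUnion (Set.mem_insert _ _) hx2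
      · obtain ⟨P, hP, hxP⟩ := h x hx hx2
        exact Set.mem_biUnion (Set.mem_insert_of_mem _ hP) hxP
    obtain ⟨I, hI, hle⟩ := (Ideal.subset_union_prime_finite (hfin.insert _) (f := id)
      (maximalIdeal S ^ 2) (maximalIdeal S ^ 2) (fun I hI h1 _ =>
        ((Set.mem_insert_iff.1 hI).resolve_left h1).1.1)).1 hsub
    rcases Set.mem_insert_iff.1 hI with rfl | hI
    · refine hbot (Submodule.eq_bot_of_le_smul_of_le_jacobson_bot (maximalIdeal S) _ hfg ?_ ?_)
      · rw [smul_eq_mul, ← pow_two]; exact hle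
      · exact maximalIdeal_le_jacobson _
    · have hPm : I = maximalIdeal S := le_antisymm (le_maximalIdeal hI.1.1.ne_top) hle
      have h0 : ringKrullDim S = 0 := by
        rw [← maximalIdeal_height_eq_ringKrullDim, Ideal.height_eq_zero_iff.2 (hPm ▸ hI)]
        rfl
      rw [h0] at hdim
      exact hbot ((Submodule.spanFinrank_eq_zero_iff_eq_bot hfg).1 (by exact_mod_cast hdim))
  have hne : Ideal.span {x} ≠ ⊤ := fun h => by
    rw [Ideal.span_singleton_eq_top] at h
    exact (mem_maximalIdeal x).1 hxm h
  have : Nontrivial (S ⧸ Ideal.span {x}) := Ideal.Quotient.nontrivial_iff.2 hne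
  have hlt := spanFinrank_maximalIdeal_quotient_lt hxm hx2
  have hreg : IsRegularLocalRing (S ⧸ Ideal.span {x}) := by
    refine IsRegularLocalRing.of_spanFinrank_maximalIdeal_le _ ?_
    have h1 : ringKrullDim S ≤ ringKrullDim (S ⧸ Ideal.span {x}) + 1 := by
      have := ringKrullDim_le_ringKrullDim_quotient_add_card (R := S) {x} (by
        simpa [IsLocalRing.ringJacobson_eq_maximalIdeal] using hxm)
      rw [Finset.coe_singleton, Finset.card_singleton] at this
      exact_mod_cast this
    rw [← hdim] at h1
    have h2 : (((maximalIdeal (S ⧸ Ideal.span {x})).spanFinrank + 1 : ℕ) : WithBot ℕ∞) ≤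
      ringKrullDim (S ⧸ Ideal.span {x}) + 1 := le_trans (by exact_mod_cast hlt) h1
    push_cast at h2
    exact ENat.WithBot.add_le_add_one_right_iff.1 h2
  obtain ⟨hdom, ys, hys, hyreg⟩ := ih _ (by omega) (S ⧸ Ideal.span {x}) rfl
  have hprime : (Ideal.span {x}).IsPrime := (Ideal.Quotient.isDomain_iff_prime _).1 hdom
  obtain ⟨P, hP, hPx⟩ := Ideal.exists_minimalPrimes_le (J := Ideal.span {x}) (I := ⊥) bot_le
  have hxP : x ∉ P := hxp P hP
  -- An element ax of P has a in P, because x is not in P. Thus P = xP, and Nakayama applies.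
  have hPbot : P = ⊥ := by
    refine Submodule.eq_bot_of_le_smul_of_le_jacobson_bot (Ideal.span {x}) _
      (IsNoetherian.noetherian P) ?_ ?_
    · intro y hy
      obtain ⟨a, rfl⟩ := Ideal.mem_span_singleton'.1 (hPx hy)
      have := (hP.1.1.mem_or_mem hy).resolve_right hxP
      rw [mul_comm]
      exact Ideal.mul_mem_mul (Ideal.mem_span_singleton_self x) this
    · rw [Ideal.span_singleton_le_iff_mem]
      exact maximalIdeal_le_jacobson _ hxm
  have hdS : IsDomain S := by
    have : (⊥ : Ideal S).IsPrime := hPbot ▸ hP.1.1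
    exact IsDomain.of_bot_isPrime S
  refine ⟨hdS, ?_⟩
  choose! g hg using Ideal.Quotient.mk_surjective (I := Ideal.span {x})
  have hmap : (ys.map g).map (Ideal.Quotient.mk (Ideal.span {x})) = ys := by
    rw [List.map_map]
    conv_rhs => rw [← List.map_id ys]
    exact List.map_congr_left fun y _ => hg y
  refine ⟨x :: ys.map g, ?_, ?_⟩
  · have h1 : (Ideal.ofList (ys.map g)).map (Ideal.Quotient.mk (Ideal.span {x})) =
        (maximalIdeal S).map (Ideal.Quotient.mk (Ideal.span {x})) := by
      rw [Ideal.map_ofList, hmap, hys]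
      exact (map_maximalIdeal_of_surjective _ Ideal.Quotient.mk_surjective).symm
    have h2 := congrArg (Ideal.comap (Ideal.Quotient.mk (Ideal.span {x}))) h1
    rw [Ideal.comap_map_of_surjective' _ Ideal.Quotient.mk_surjective,
      Ideal.comap_map_of_surjective' _ Ideal.Quotient.mk_surjective, Ideal.mk_ker,
      sup_eq_left.2 ((Ideal.span_singleton_le_iff_mem _).2 hxm)] at h2
    rw [Ideal.ofList_cons, sup_comm, h2]
  · refine IsWeaklyRegular.cons' ?_ ?_
    · have hx0 : x ≠ 0 := fun h => hxP (h ▸ P.zero_mem)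
      exact (IsLeftCancelMulZero.mul_left_cancel_of_ne_zero hx0)
    · rw [hmap]
      have he : (Ideal.span {x} : Ideal S) = x • (⊤ : Ideal S) := by
        ext y; simp [Ideal.mem_span_singleton', Submodule.mem_smul_pointwise_iff_exists, mul_comm]
      refine ((Submodule.quotEquivOfEq _ _ he).toAddEquiv.isWeaklyRegular_congr
        (List.forall₂_same.2 fun r _ z => ?_)).1 hyreg
      obtain ⟨r, rfl⟩ := Ideal.Quotient.mk_surjective r
      obtain ⟨z, rfl⟩ := Ideal.Quotient.mk_surjective z
      rfl

theorem IsRegularLocalRing.exists_isWeaklyRegular (S : Type u) [CommRing S]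
    [IsRegularLocalRing S] :
    ∃ xs : List S, Ideal.ofList xs = maximalIdeal S ∧ IsWeaklyRegular S xs :=
  (isDomain_and_exists_isWeaklyRegular_aux _ S rfl).2

end RegularLocal

/-! ### Powers of regular sequences, a freeness criterion, and socles -/

section RegularSequences

open RingTheory.Sequence Pointwise

universe u v

theorem isWeaklyRegular_of_subsingleton {S M : Type*} [CommRing S] [AddCommGroup M] [Module S M]
    [Subsingleton M] (xs : List S) : IsWeaklyRegular M xs := by
  rw [isWeaklyRegular_iff]
  intro i hi a b _
  exact Subsingleton.elim a b

/-- Regularity of x on the outer terms passes to the middle one. Regularity on M₃ also keeps M₁/x →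
M₂/x injective, so the reduced sequence is short exact and the induction continues. -/
theorem IsWeaklyRegular.of_exact {S : Type*} [CommRing S] (xs : List S) :
    ∀ {M₁ M₂ M₃ : Type v} [AddCommGroup M₁] [Module S M₁] [AddCommGroup M₂] [Module S M₂]
      [AddCommGroup M₃] [Module S M₃] (f : M₁ →ₗ[S] M₂) (g : M₂ →ₗ[S] M₃),
      Function.Injective f → Function.Exact f g → Function.Surjective g →
      IsWeaklyRegular M₁ xs → IsWeaklyRegular M₃ xs → IsWeaklyRegular M₂ xs := by
  induction xs with
  | nil => intros; exact IsWeaklyRegular.nil _ _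
  | cons x xs ih =>
    intro M₁ M₂ M₃ _ _ _ _ _ _ f g hf hfg hg h1 h3
    rw [isWeaklyRegular_cons_iff] at h1 h3 ⊢
    refine ⟨isSMulRegular_of_range_eq_ker hf hfg.linearMap_ker_eq.symm h1.1 h3.1,
      ih (QuotSMulTop.map x f) (QuotSMulTop.map x g) ?_ (QuotSMulTop.map_exact x hfg hg)
        (QuotSMulTop.map_surjective x hg) h1.2 h3.2⟩
    have h0 : Function.Exact (0 : PUnit.{1} →ₗ[S] M₁) f := by
      rw [LinearMap.exact_zero_iff_injective]; exact hf
    have := QuotSMulTop.map_first_exact_on_four_term_exact_of_isSMulRegular_last h0 hfg h3.1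
    rw [map_zero, LinearMap.exact_zero_iff_injective] at this
    exact this

/-- Induction along 0 → M/xⁿM → M/xⁿ⁺¹M → M/xM → 0, whose first map is multiplication by x. It
starts from the zero module, on which every sequence is weakly regular. -/
theorem isWeaklyRegular_quotSMulTop_pow {S : Type*} {M : Type v} [CommRing S] [AddCommGroup M]
    [Module S M] {x : S} {xs : List S} (h : IsWeaklyRegular M (x :: xs)) (n : ℕ) :
    IsWeaklyRegular (QuotSMulTop (x ^ n) M) xs := by
  rw [isWeaklyRegular_cons_iff] at h
  induction n with
  | zero =>
    have : Subsingleton (QuotSMulTop (x ^ 0) M) := by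
      rw [pow_zero, QuotSMulTop, one_smul]
      exact Submodule.Quotient.subsingleton_iff.2 rfl
    exact isWeaklyRegular_of_subsingleton xs
  | succ n ih =>
    refine IsWeaklyRegular.of_exact xs
      (Submodule.mapQ (x ^ n • (⊤ : Submodule S M)) (x ^ (n + 1) • (⊤ : Submodule S M))
        (LinearMap.lsmul S M x) ?_)
      (Submodule.mapQ (x ^ (n + 1) • (⊤ : Submodule S M)) (x • (⊤ : Submodule S M))
        LinearMap.id ?_) ?_ ?_ ?_ ih h.2
    · intro y hy
      obtain ⟨z, -, rfl⟩ := (Submodule.mem_smul_pointwise_iff_exists _ _ _).1 hy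
      exact (Submodule.mem_smul_pointwise_iff_exists _ _ _).2
        ⟨z, Submodule.mem_top, by simp [smul_smul, pow_succ]⟩
    · intro y hy
      obtain ⟨z, -, rfl⟩ := (Submodule.mem_smul_pointwise_iff_exists _ _ _).1 hy
      exact (Submodule.mem_smul_pointwise_iff_exists _ _ _).2
        ⟨x ^ n • z, Submodule.mem_top, by simp [smul_smul, pow_succ']⟩
    · rw [injective_iff_map_eq_zero]
      intro y hy
      obtain ⟨y, rfl⟩ := Submodule.Quotient.mk_surjective _ y
      rw [Submodule.mapQ_apply, Submodule.Quotient.mk_eq_zero] at hy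
      obtain ⟨z, -, hz⟩ := (Submodule.mem_smul_pointwise_iff_exists _ _ _).1 hy
      rw [Submodule.Quotient.mk_eq_zero]
      refine (Submodule.mem_smul_pointwise_iff_exists _ _ _).2 ⟨z, Submodule.mem_top, h.1 ?_⟩
      simpa [smul_smul, pow_succ'] using hz
    · intro y
      obtain ⟨y, rfl⟩ := Submodule.Quotient.mk_surjective _ y
      rw [Submodule.mapQ_apply, Submodule.Quotient.mk_eq_zero]
      constructor
      · intro hy
        obtain ⟨z, -, rfl⟩ := (Submodule.mem_smul_pointwise_iff_exists _ _ _).1 hy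
        exact ⟨Submodule.Quotient.mk z, rfl⟩
      · rintro ⟨z, hz⟩
        obtain ⟨z, rfl⟩ := Submodule.Quotient.mk_surjective _ z
        rw [Submodule.mapQ_apply, Submodule.Quotient.eq] at hz
        obtain ⟨w, -, hw⟩ := (Submodule.mem_smul_pointwise_iff_exists _ _ _).1 hz
        refine (Submodule.mem_smul_pointwise_iff_exists _ _ _).2
          ⟨z - x ^ n • w, Submodule.mem_top, ?_⟩
        rw [smul_sub, smul_smul, ← pow_succ', hw]
        simp
    · intro y
      obtain ⟨y, rfl⟩ := Submodule.Quotient.mk_surjective _ y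
      exact ⟨Submodule.Quotient.mk y, rfl⟩

theorem isWeaklyRegular_map_pow {S : Type*} [CommRing S] (n : ℕ) (xs : List S) :
    ∀ {M : Type v} [AddCommGroup M] [Module S M], IsWeaklyRegular M xs →
      IsWeaklyRegular M (xs.map (· ^ n)) := by
  induction xs with
  | nil => intros; exact IsWeaklyRegular.nil _ _
  | cons x xs ih =>
    intro M _ _ h
    rw [List.map_cons]
    exact IsWeaklyRegular.cons (((isWeaklyRegular_cons_iff _ _ _).1 h).1.pow n)
      (ih (isWeaklyRegular_quotSMulTop_pow h n))

/-- A finite module over a Noetherian local ring is free as soon as the maximal ideal is generated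
by a sequence that is regular both on the ring and on the module. -/
theorem free_of_isWeaklyRegular (n : ℕ) :
    ∀ {S : Type u} {M : Type v} [CommRing S] [IsLocalRing S] [IsNoetherianRing S]
      [AddCommGroup M] [Module S M] [Module.Finite S M] (xs : List S), xs.length = n →
      Ideal.ofList xs = maximalIdeal S → IsWeaklyRegular S xs → IsWeaklyRegular M xs →
      Module.Free S M := by
  induction n with
  | zero =>
    intro S M _ _ _ _ _ _ xs hlen hxs _ _
    rw [List.length_eq_zero_iff] at hlen
    subst hlen
    rw [Ideal.ofList_nil] at hxs
    let := ((isField_iff_maximalIdeal_eq (R := S)).2 hxs.symm).toField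
    infer_instance
  | succ n ih =>
    intro S M _ _ _ _ _ _ xs hlen hxs hS hM
    obtain _ | ⟨x, xs⟩ := xs
    · simp at hlen
    have hx : x ∈ maximalIdeal S := by
      rw [← hxs]; exact Ideal.subset_span List.mem_cons_self
    rw [isWeaklyRegular_cons_iff'] at hS hM
    have hne : Ideal.span {x} ≠ ⊤ := fun h => by
      rw [Ideal.span_singleton_eq_top] at h
      exact (mem_maximalIdeal x).1 hx h
    have : Nontrivial (S ⧸ Ideal.span {x}) := Ideal.Quotient.nontrivial_iff.2 hne
    have : Module.FinitePresentation S M := Module.finitePresentation_of_finite S M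
    have : Module.Finite (S ⧸ Ideal.span {x}) (QuotSMulTop x M) :=
      Module.Finite.of_restrictScalars_finite S (S ⧸ Ideal.span {x}) (QuotSMulTop x M)
    -- Freeness over S/x of M/xM lifts to M because x is M-regular and lies in the Jacobson radical.
    refine (Module.free_quotSMulTop_iff_free S M (x := x)
      (maximalIdeal_le_jacobson _ hx) hM.1).1 (ih (xs.map (Ideal.Quotient.mk (Ideal.span {x})))
        (by simpa using hlen) ?_ ?_ hM.2)
    · rw [← map_maximalIdeal_of_surjective (Ideal.Quotient.mk (Ideal.span {x}))
        Ideal.Quotient.mk_surjective, ← hxs, Ideal.ofList_cons, Ideal.map_sup,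
        Ideal.map_quotient_self, bot_sup_eq, Ideal.map_ofList]
    · have he : (Ideal.span {x} : Ideal S) = x • (⊤ : Ideal S) := by
        ext y; simp [Ideal.mem_span_singleton', Submodule.mem_smul_pointwise_iff_exists, mul_comm]
      refine ((Submodule.quotEquivOfEq _ _ he).toAddEquiv.isWeaklyRegular_congr
        (List.forall₂_same.2 fun r _ z => ?_)).2 hS.2
      obtain ⟨r, rfl⟩ := Ideal.Quotient.mk_surjective r
      obtain ⟨z, rfl⟩ := Ideal.Quotient.mk_surjective z
      rfl

/-- Modulo the `n`-th powers of a regular sequence, the socle is generated by the product of the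
`(n - 1)`-st powers. -/
theorem mem_of_smul_mem_ofList_pow {S : Type u} [CommRing S] [IsLocalRing S] (n : ℕ)
    (xs : List S) : ∀ {M : Type v} [AddCommGroup M] [Module S M] [IsNoetherian S M],
      (∀ x ∈ xs, x ∈ maximalIdeal S) → IsWeaklyRegular M xs → ∀ a : M,
      (∀ x ∈ xs, x • a ∈ Ideal.ofList (xs.map (· ^ (n + 1))) • (⊤ : Submodule S M)) →
      ∃ b : M, a - (xs.map (· ^ n)).prod • b ∈
        Ideal.ofList (xs.map (· ^ (n + 1))) • (⊤ : Submodule S M) := by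
  induction xs with
  | nil => intro M _ _ _ _ _ a _; exact ⟨a, by simp⟩
  | cons x xs ih =>
    intro M _ _ _ hm hreg a ha
    simp only [List.map_cons, Ideal.ofList_cons_smul, List.prod_cons] at ha ⊢
    set I := Ideal.ofList (xs.map (· ^ (n + 1)))
    -- In the Noetherian local setting a weakly regular sequence in m may be permuted, so x can be
    -- moved behind the powers of the others.
    have hxI : IsSMulRegular (M ⧸ (I • ⊤ : Submodule S M)) x := by
      have h1 : IsWeaklyRegular M (xs.map (· ^ (n + 1)) ++ [x]) := by
        refine isWeaklyRegular_of_perm_of_subset_maximalIdeal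
          (rs := x :: xs.map (· ^ (n + 1))) ?_ (List.perm_append_singleton x _).symm ?_
        · rw [isWeaklyRegular_cons_iff] at hreg ⊢
          exact ⟨hreg.1, isWeaklyRegular_map_pow _ _ hreg.2⟩
        · intro r hr
          obtain rfl | hr := List.mem_cons.1 hr
          · exact hm r List.mem_cons_self
          · obtain ⟨y, hy, rfl⟩ := List.mem_map.1 hr
            exact Ideal.pow_mem_of_mem _ (hm y (List.mem_cons_of_mem _ hy)) _ (Nat.succ_pos n)
      rw [isWeaklyRegular_append_iff, isWeaklyRegular_singleton_iff] at h1
      exact h1.2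
    -- From xa ∈ xⁿ⁺¹M + IM, cancel x modulo IM.
    obtain ⟨b, hb⟩ : ∃ b : M, a - x ^ n • b ∈ (I • ⊤ : Submodule S M) := by
      obtain ⟨y, hy, z, hz, hyz⟩ := Submodule.mem_sup.1 (ha x List.mem_cons_self)
      obtain ⟨b, -, rfl⟩ := (Submodule.mem_smul_pointwise_iff_exists _ _ _).1 hy
      refine ⟨b, mem_of_isSMulRegular_quotient_of_smul_mem hxI ?_⟩
      rw [smul_sub, smul_smul, ← pow_succ', ← hyz, add_sub_cancel_left]
      exact hz
    have hmk : ∀ z : M, (Submodule.Quotient.mk z : QuotSMulTop x M) ∈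
        (I • ⊤ : Submodule S (QuotSMulTop x M)) ↔
        z ∈ x • (⊤ : Submodule S M) ⊔ I • (⊤ : Submodule S M) := by
      intro z
      have : (I • ⊤ : Submodule S (QuotSMulTop x M)) =
          (I • ⊤ : Submodule S M).map (Submodule.mkQ (x • (⊤ : Submodule S M))) := by
        rw [Submodule.map_smul'', Submodule.map_top, Submodule.range_mkQ]
      rw [this, ← Submodule.comap_map_mkQ]
      rfl
    -- Cancelling xⁿ in the relation for y • xⁿ • b shows that the class of b satisfies the
    -- hypothesis of the induction on M/xM.
    have hxb : ∀ y ∈ xs, y • (Submodule.Quotient.mk b : QuotSMulTop x M) ∈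
        (I • ⊤ : Submodule S (QuotSMulTop x M)) := by
      intro y hy
      rw [← Submodule.Quotient.mk_smul, hmk]
      have h1 : y • x ^ n • b ∈ x ^ (n + 1) • (⊤ : Submodule S M) ⊔ I • (⊤ : Submodule S M) := by
        have h2 := ha y (List.mem_cons_of_mem _ hy)
        have h3 : y • (a - x ^ n • b) ∈ x ^ (n + 1) • (⊤ : Submodule S M) ⊔
            I • (⊤ : Submodule S M) := Submodule.mem_sup_right (Submodule.smul_mem _ y hb)
        have := Submodule.sub_mem _ h2 h3
        rwa [smul_sub, sub_sub_cancel] at this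
      obtain ⟨u, hu, w, hw, huw⟩ := Submodule.mem_sup.1 h1
      obtain ⟨c, -, rfl⟩ := (Submodule.mem_smul_pointwise_iff_exists _ _ _).1 hu
      have h4 : x ^ n • (y • b - x • c) ∈ (I • ⊤ : Submodule S M) := by
        rw [smul_sub, smul_smul, smul_smul, ← pow_succ, mul_comm, ← smul_smul, ← huw,
          add_sub_cancel_left]
        exact hw
      have h5 := mem_of_isSMulRegular_quotient_of_smul_mem (hxI.pow n) h4
      exact Submodule.mem_sup.2 ⟨x • c, Submodule.smul_mem_pointwise_smul _ _ _ Submodule.mem_top,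
        _, h5, by abel⟩
    obtain ⟨c, hc⟩ := ih (fun y hy => hm y (List.mem_cons_of_mem _ hy))
      ((isWeaklyRegular_cons_iff _ _ _).1 hreg).2 (Submodule.Quotient.mk b) hxb
    obtain ⟨c, rfl⟩ := Submodule.Quotient.mk_surjective _ c
    rw [← Submodule.Quotient.mk_smul, ← Submodule.Quotient.mk_sub, hmk] at hc
    obtain ⟨u, hu, w, hw, huw⟩ := Submodule.mem_sup.1 hc
    obtain ⟨d, -, rfl⟩ := (Submodule.mem_smul_pointwise_iff_exists _ _ _).1 hu
    refine ⟨c, Submodule.mem_sup.2 ⟨x ^ (n + 1) • d,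
      Submodule.smul_mem_pointwise_smul _ _ _ Submodule.mem_top, x ^ n • w + (a - x ^ n • b),
      Submodule.add_mem _ (Submodule.smul_mem _ _ hw) hb, ?_⟩⟩
    have : w = b - (xs.map (· ^ n)).prod • c - x • d := by rw [← huw]; abel
    rw [this, smul_sub, smul_sub, smul_smul, smul_smul, ← pow_succ]
    abel

end RegularSequences

/-! ### Duality over a local ring and modulo powers of parameters -/

section Duality

theorem mem_smul_top_of_forall_dual {S M : Type*} [CommRing S] [AddCommGroup M] [Module S M]
    [Module.Free S M] [Module.Finite S M] (I : Ideal S) (x : M)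
    (h : ∀ φ : M →ₗ[S] S, φ x ∈ I) : x ∈ (I • ⊤ : Submodule S M) := by
  have b := Module.Free.chooseBasis S M
  rw [← b.sum_repr x]
  exact Submodule.sum_mem _ fun i _ => Submodule.smul_mem_smul (h (b.coord i)) Submodule.mem_top

theorem map_mem_of_mem_smul_top {S M : Type*} [CommRing S] [AddCommGroup M] [Module S M]
    {I : Ideal S} {x : M} (hx : x ∈ (I • ⊤ : Submodule S M)) (φ : M →ₗ[S] S) : φ x ∈ I := by
  have h := Submodule.mem_map_of_mem (f := φ) hx
  rw [Submodule.map_smul''] at h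
  exact Submodule.smul_le.2 (fun r hr s _ => Ideal.mul_mem_right s I hr) h

/-- A bilinear form on a finite free module over a local ring that is nondegenerate modulo the
maximal ideal is unimodular. -/
theorem exists_eq_of_nondegenerate_mod_maximalIdeal {S M : Type*} [CommRing S] [IsLocalRing S]
    [AddCommGroup M] [Module S M] [Module.Free S M] [Module.Finite S M]
    (B : M →ₗ[S] M →ₗ[S] S)
    (hB : ∀ a, (∀ r, B a r ∈ maximalIdeal S) → a ∈ (maximalIdeal S • ⊤ : Submodule S M))
    (φ : M →ₗ[S] S) : ∃ c, B c = φ := by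
  classical
  let b := Module.Free.chooseBasis S M
  let A : Matrix _ _ S := Matrix.of fun i j => B (b i) (b j)
  -- A left null vector of the Gram matrix over the residue field lifts to an element pairing into m
  -- with everything. By hypothesis that element is in mM, so all its coordinates vanish in the
  -- residue field.
  have hA : IsUnit A.det := by
    refine isUnit_of_map_unit (residue S) _ (isUnit_iff_ne_zero.2 fun h => ?_)
    rw [RingHom.map_det] at h
    obtain ⟨v, hv0, hv⟩ := Matrix.exists_vecMul_eq_zero_iff.2 h
    choose w hw using fun i => residue_surjective (v i)
    refine hv0 (funext fun i => ?_)
    rw [Pi.zero_apply, ← hw i, residue_eq_zero_iff]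
    have hmem : (∑ i, w i • b i) ∈ (maximalIdeal S • ⊤ : Submodule S M) := by
      refine hB _ fun r => ?_
      rw [← b.sum_repr r, map_sum]
      refine Ideal.sum_mem _ fun j _ => ?_
      rw [map_smul, smul_eq_mul]
      refine Ideal.mul_mem_left _ _ ?_
      rw [← residue_eq_zero_iff]
      have := congrFun hv j
      simpa [Matrix.vecMul, dotProduct, A, ← hw] using this
    have := map_mem_of_mem_smul_top hmem (b.coord i)
    rwa [b.coord_apply, b.repr_sum_self] at this
  refine ⟨∑ i, (Matrix.vecMul (fun j => φ (b j)) A⁻¹) i • b i, b.ext fun j => ?_⟩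
  have h1 : Matrix.vecMul (Matrix.vecMul (fun j => φ (b j)) A⁻¹) A = fun j => φ (b j) := by
    rw [Matrix.vecMul_vecMul, Matrix.nonsing_inv_mul _ hA, Matrix.vecMul_one]
  have h2 := congrFun h1 j
  rw [← h2]
  simp [Matrix.vecMul, dotProduct, A]

/-- Modulo the powers of a regular system of parameters of a regular local ring, there is a nonzero
element that lies in every nonzero ideal. -/
theorem exists_mem_span_sup_of_isWeaklyRegular {S : Type*} [CommRing S]
    [IsLocalRing S] [IsNoetherianRing S] (n : ℕ) {xs : List S}
    (hxs : Ideal.ofList xs = maximalIdeal S) (hreg : RingTheory.Sequence.IsWeaklyRegular S xs) :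
    ∃ s : S, s ∉ Ideal.ofList (xs.map (· ^ (n + 1))) ∧
      ∀ a ∉ Ideal.ofList (xs.map (· ^ (n + 1))), ∃ r, r * a - s ∈
        Ideal.ofList (xs.map (· ^ (n + 1))) := by
  set I := Ideal.ofList (xs.map (· ^ (n + 1)))
  have hm : ∀ x ∈ xs, x ∈ maximalIdeal S := fun x hx => by
    rw [← hxs]; exact Ideal.subset_span hx
  have hIm : I ≤ maximalIdeal S := by
    refine Ideal.span_le.2 fun y hy => ?_
    obtain ⟨x, hx, rfl⟩ := List.mem_map.1 hy
    exact Ideal.pow_mem_of_mem _ (hm x hx) _ (Nat.succ_pos n)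
  set s := (xs.map (· ^ n)).prod
  have hs : ∀ c ∈ maximalIdeal S, s * c ∈ I := by
    intro c hc
    rw [← hxs] at hc
    have : Ideal.ofList xs ≤ I.colon {s} := by
      refine Ideal.span_le.2 fun x hx => Submodule.mem_colon_singleton.2 ?_
      have h1 : x ^ (n + 1) ∣ x * s := by
        rw [pow_succ']
        exact mul_dvd_mul_left _ (List.dvd_prod (List.mem_map_of_mem hx))
      exact Ideal.mem_of_dvd _ h1 (Ideal.subset_span (List.mem_map_of_mem hx))
    have := Submodule.mem_colon_singleton.1 (this hc)
    rwa [smul_eq_mul, mul_comm] at this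
  obtain ⟨N, hN⟩ : ∃ N, maximalIdeal S ^ N ≤ I := by
    refine Ideal.exists_pow_le_of_le_radical_of_fg ?_ (IsNoetherian.noetherian _)
    rw [← hxs]
    exact Ideal.span_le.2 fun x hx => ⟨n + 1, Ideal.subset_span (List.mem_map_of_mem hx)⟩
  -- Take the least power of m that multiplies a into I. One step earlier, some multiple of a is a
  -- nonzero socle element modulo I, hence a multiple of s.
  have hsoc : ∀ a ∉ I, ∃ c, c * a ∉ I ∧ ∃ b, c * a - s * b ∈ I := by
    classical
    intro a ha
    have hex : ∃ k, ∀ c ∈ maximalIdeal S ^ k, c * a ∈ I :=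
      ⟨N, fun c hc => Ideal.mul_mem_right _ _ (hN hc)⟩
    obtain ⟨k, hk⟩ : ∃ k, Nat.find hex = k + 1 := by
      refine Nat.exists_eq_succ_of_ne_zero fun h => ha ?_
      have := Nat.find_spec hex
      rw [h] at this
      simpa using this 1 (by simp)
    have hmin := Nat.find_min hex (m := k) (by omega)
    have hspec := Nat.find_spec hex
    rw [hk] at hspec
    push Not at hmin
    obtain ⟨c, hc, hca⟩ := hmin
    obtain ⟨b, hb⟩ := mem_of_smul_mem_ofList_pow n xs hm hreg (c * a) (fun x hx => by
      rw [smul_eq_mul, Ideal.mul_top, smul_eq_mul, ← mul_assoc]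
      exact hspec _ (by rw [pow_succ']; exact Ideal.mul_mem_mul (hm x hx) hc))
    rw [smul_eq_mul, Ideal.mul_top, smul_eq_mul] at hb
    exact ⟨c, hca, b, hb⟩
  refine ⟨s, fun hsI => ?_, fun a ha => ?_⟩
  · have h1 : (1 : S) ∉ I := fun h => (maximalIdeal.isMaximal S).ne_top
      ((Ideal.eq_top_iff_one _).2 (hIm h))
    obtain ⟨c, hc, b, hb⟩ := hsoc 1 h1
    refine hc ?_
    have := Ideal.add_mem _ hb (Ideal.mul_mem_right b _ hsI)
    rwa [sub_add_cancel] at this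
  · obtain ⟨c, hca, b, hb⟩ := hsoc a ha
    have hbu : IsUnit b := by
      by_contra hbu
      refine hca ?_
      have := Ideal.add_mem _ hb (hs b ((mem_maximalIdeal _).2 hbu))
      rwa [sub_add_cancel] at this
    obtain ⟨u, rfl⟩ := hbu
    refine ⟨↑u⁻¹ * c, ?_⟩
    have := Ideal.mul_mem_left _ (↑u⁻¹ : S) hb
    rwa [mul_sub, mul_left_comm _ s, Units.inv_mul, mul_one, ← mul_assoc] at this

end Duality

/-! ### Freeness of `F^e_* S` and a generator of the `p^{-e}`-linear maps -/

namespace FPush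

variable {p : ℕ} {S : Type*} [CommRing S] [Fact p.Prime] [CharP S p]

theorem of_mem_smul_top_iff (e : ℕ) (I : Ideal S) (x : S) :
    of p e x ∈ (I • ⊤ : Submodule S (FPush p e S)) ↔ x ∈ frobPower p I e := by
  constructor
  · intro h
    have key : ∀ y ∈ (I • ⊤ : Submodule S (FPush p e S)), (of p e).symm y ∈ frobPower p I e := by
      intro y hy
      refine Submodule.smul_induction_on hy (fun r hr y _ => ?_) fun y z hy hz => ?_
      · obtain ⟨y, rfl⟩ := (of p e).surjective y
        rw [smul_of, AddEquiv.symm_apply_apply]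
        exact Ideal.mul_mem_right _ _ (Ideal.mem_map_of_mem (iterateFrobenius S p e) hr)
      · rw [map_add]; exact Ideal.add_mem _ hy hz
    exact key _ h
  · intro h
    induction h using Submodule.span_induction with
    | mem x hx =>
      obtain ⟨r, hr, rfl⟩ := hx
      have h1 := Submodule.smul_mem_smul hr (Submodule.mem_top (x := of p e (1 : S)))
      rw [smul_of, mul_one] at h1
      exact h1
    | zero => rw [map_zero]; exact Submodule.zero_mem _
    | add x y _ _ hx hy => rw [map_add]; exact Submodule.add_mem _ hx hy
    | smul a x _ hx =>
      -- Here a multiplies inside `F^e_*`, not through Frobenius, so stability of the submodule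
      -- under it needs an argument.
      have h1 : ∀ y ∈ (I • ⊤ : Submodule S (FPush p e S)),
          of p e (a * (of p e).symm y) ∈ (I • ⊤ : Submodule S (FPush p e S)) := by
        intro y hy
        refine Submodule.smul_induction_on hy (fun r hr y _ => ?_) fun y z hy hz => ?_
        · obtain ⟨y, rfl⟩ := (of p e).surjective y
          rw [smul_of, AddEquiv.symm_apply_apply, mul_left_comm, ← smul_of]
          exact Submodule.smul_mem_smul hr Submodule.mem_top
        · rw [map_add, mul_add, map_add]; exact Submodule.add_mem _ hy hz
      exact h1 _ hx

theorem module_finite (hF : IsFFinite p S) (e : ℕ) : Module.Finite S (FPush p e S) := by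
  have h1 : (frobenius S p).Finite := by
    have : iterateFrobenius S p 1 = frobenius S p := by ext x; simp [frobenius_def]
    rw [← this]
    have h : Module.Finite S (FPush p 1 S) := hF
    exact h
  have h2 : ∀ e, (iterateFrobenius S p e).Finite := by
    intro e
    induction e with
    | zero =>
      have : iterateFrobenius S p 0 = RingHom.id S := by ext x; simp
      rw [this]
      exact RingHom.Finite.id S
    | succ e ih =>
      have : iterateFrobenius S p (e + 1) = (iterateFrobenius S p e).comp (frobenius S p) := by
        ext x
        rw [RingHom.comp_apply, iterateFrobenius_def, iterateFrobenius_def, frobenius_def,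
          ← pow_mul, ← pow_succ']
      rw [this]
      exact ih.comp h1
  exact h2 e

/-- The `S`-bilinear form `(a, b) ↦ φ (F^e_* (a b))` on `F^e_* S`. -/
noncomputable def pairing {e : ℕ} (φ : CartierMap p e S) :
    FPush p e S →ₗ[S] FPush p e S →ₗ[S] S :=
  LinearMap.mk₂ S (fun a b => φ (of p e ((of p e).symm a * (of p e).symm b)))
    (fun a a' b => by simp only [map_add, add_mul])
    (fun r a b => by
      obtain ⟨a, rfl⟩ := (of p e).surjective a
      rw [smul_of, AddEquiv.symm_apply_apply, AddEquiv.symm_apply_apply, mul_assoc, ← smul_of,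
        map_smul])
    (fun a b b' => by simp only [map_add, mul_add])
    (fun r a b => by
      obtain ⟨b, rfl⟩ := (of p e).surjective b
      rw [smul_of, AddEquiv.symm_apply_apply, AddEquiv.symm_apply_apply, mul_left_comm, ← smul_of,
        map_smul])

theorem pairing_eq_premul {e : ℕ} (φ : CartierMap p e S) (a : S) :
    pairing φ (of p e a) = φ.premul a := rfl

variable [IsRegularLocalRing S]

/-- A parameter x acts on `F^e_* S` as x^(p^e), and powers of a regular sequence are regular; the
freeness criterion applies. -/
theorem module_free (hF : IsFFinite p S) (e : ℕ) : Module.Free S (FPush p e S) := by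
  have := module_finite hF e
  obtain ⟨xs, hxs, hreg⟩ := IsRegularLocalRing.exists_isWeaklyRegular S
  refine free_of_isWeaklyRegular _ xs rfl hxs hreg ?_
  refine ((of p e).isWeaklyRegular_congr (as := xs.map (· ^ p ^ e)) (bs := xs) ?_).1
    (isWeaklyRegular_map_pow _ xs hreg)
  rw [List.forall₂_map_left_iff]
  exact List.forall₂_same.2 fun r _ x => rfl

theorem _root_.exists_notMem_frobPower (e : ℕ) :
    ∃ s : S, s ∉ frobPower p (maximalIdeal S) e ∧
      ∀ a ∉ frobPower p (maximalIdeal S) e, ∃ r, r * a - s ∈ frobPower p (maximalIdeal S) e := by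
  obtain ⟨xs, hxs, hreg⟩ := IsRegularLocalRing.exists_isWeaklyRegular S
  -- The socle statement concerns exponent n + 1; here n = p^e - 1.
  have hq : p ^ e - 1 + 1 = p ^ e :=
    Nat.sub_add_cancel (Nat.one_le_pow _ _ (Fact.out : p.Prime).pos)
  have hI : frobPower p (maximalIdeal S) e = Ideal.ofList (xs.map (· ^ (p ^ e - 1 + 1))) := by
    rw [frobPower, ← hxs, Ideal.map_ofList, hq]
    congr 2
  rw [hI]
  exact exists_mem_span_sup_of_isWeaklyRegular _ hxs hreg

/-- There is a `p^{-e}`-linear map on a regular local ring whose kernel contains no nonzero ideal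
modulo the Frobenius power of the maximal ideal. -/
theorem exists_nondegenerate (hF : IsFFinite p S) (e : ℕ) :
    ∃ φ : CartierMap p e S, ∀ a : S, (∀ r, φ (of p e (a * r)) ∈ maximalIdeal S) →
      a ∈ frobPower p (maximalIdeal S) e := by
  have := module_finite hF e
  have := module_free hF e
  obtain ⟨s, hs, h⟩ := exists_notMem_frobPower (p := p) (S := S) e
  -- On a finite free module, an element outside n times the module is detected by some functional.
  -- Every a outside n^[p^e] has a multiple congruent to s, so this φ detects a as well.
  obtain ⟨φ, hφ⟩ : ∃ φ : CartierMap p e S, φ (of p e s) ∉ maximalIdeal S := by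
    by_contra! hc
    exact hs ((of_mem_smul_top_iff _ _ _).1 (mem_smul_top_of_forall_dual _ _ hc))
  refine ⟨φ, fun a ha => ?_⟩
  by_contra hna
  obtain ⟨r, hr⟩ := h a hna
  have h1 := map_mem_of_mem_smul_top ((of_mem_smul_top_iff _ _ _).2 hr) φ
  rw [map_sub, map_sub, mul_comm] at h1
  exact hφ ((Submodule.sub_mem_iff_right _ (ha r)).1 h1)

theorem exists_eq_premul (hF : IsFFinite p S) {e : ℕ} {φ : CartierMap p e S}
    (hφ : ∀ a : S, (∀ r, φ (of p e (a * r)) ∈ maximalIdeal S) →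
      a ∈ frobPower p (maximalIdeal S) e) (ψ : CartierMap p e S) :
    ∃ c, ψ = φ.premul c := by
  have := module_finite hF e
  have := module_free hF e
  obtain ⟨c, hc⟩ := exists_eq_of_nondegenerate_mod_maximalIdeal (pairing φ) (fun a ha => by
    obtain ⟨a, rfl⟩ := (of p e).surjective a
    exact (of_mem_smul_top_iff _ _ _).2 (hφ a fun r => ha (of p e r))) ψ
  obtain ⟨c, rfl⟩ := (of p e).surjective c
  exact ⟨c, by rw [← hc, pairing_eq_premul]⟩

end FPush

/-! ### Dual systems for pairings into the residue field -/

section Pairing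

variable {S X Y Z : Type*} [CommRing S] [IsLocalRing S] [AddCommGroup X] [Module S X]
  [AddCommGroup Y] [Module S Y] [AddCommGroup Z] [Module S Z]

/-- There are dual systems of size `n` for the pairing `P`. -/
def HasDualPair (P : X →ₗ[S] Y →ₗ[S] ResidueField S) (n : ℕ) : Prop :=
  ∃ (x : Fin n → X) (y : Fin n → Y), ∀ i j, P (x i) (y j) = if i = j then 1 else 0

theorem HasDualPair.flip {P : X →ₗ[S] Y →ₗ[S] ResidueField S} {n : ℕ} (h : HasDualPair P n) :
    HasDualPair P.flip n := by
  obtain ⟨x, y, h⟩ := h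
  exact ⟨y, x, fun i j => by rw [LinearMap.flip_apply, h]; simp only [eq_comm]⟩

theorem hasDualPair_flip {P : X →ₗ[S] Y →ₗ[S] ResidueField S} {n : ℕ} :
    HasDualPair P.flip n ↔ HasDualPair P n :=
  ⟨fun h => h.flip, fun h => h.flip⟩

theorem length_pi_residueField (n : ℕ) : Module.length S (Fin n → ResidueField S) = n := by
  have : IsSimpleModule S (ResidueField S) :=
    isSimpleModule_iff_quot_maximal.2 ⟨maximalIdeal S, inferInstance, ⟨LinearEquiv.refl S _⟩⟩
  rw [Module.length_pi_of_fintype]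
  simp [Module.length_eq_one]

/-- Evaluation of a pairing at the second half of a dual pair. -/
noncomputable def evalPairing (P : X →ₗ[S] Y →ₗ[S] ResidueField S) {n : ℕ} (y : Fin n → Y) :
    X →ₗ[S] (Fin n → ResidueField S) :=
  LinearMap.pi fun j => P.flip (y j)

theorem evalPairing_surjective (P : X →ₗ[S] Y →ₗ[S] ResidueField S) {n : ℕ} {x : Fin n → X}
    {y : Fin n → Y} (h : ∀ i j, P (x i) (y j) = if i = j then 1 else 0) :
    Function.Surjective (evalPairing P y) := by
  intro v
  choose w hw using fun i => residue_surjective (v i)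
  refine ⟨∑ i, w i • x i, funext fun j => ?_⟩
  simp only [evalPairing, LinearMap.pi_apply, LinearMap.flip_apply, map_sum, map_smul, h]
  simp [← hw, Algebra.smul_def]

/-- The supremum of the sizes of dual pairs of a pairing into the residue field is the length of
the quotient by the left kernel. -/
theorem sSup_hasDualPair_eq_length (P : X →ₗ[S] Y →ₗ[S] ResidueField S) (g : X →ₗ[S] Z)
    (hg : Function.Surjective g) (hP : ∀ x, g x = 0 ↔ ∀ y, P x y = 0) :
    sSup {n : ℕ∞ | ∃ m : ℕ, HasDualPair P m ∧ n = m} = Module.length S Z := by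
  have key : ∀ (m : ℕ) (y : Fin m → Y), ∃ G : Z →ₗ[S] (Fin m → ResidueField S),
      ∀ x, G (g x) = evalPairing P y x := by
    intro m y
    have hle : LinearMap.ker g ≤ LinearMap.ker (evalPairing P y) := fun x hx => by
      rw [LinearMap.mem_ker] at hx ⊢
      exact funext fun j => (hP x).1 hx (y j)
    refine ⟨(LinearMap.ker g).liftQ (evalPairing P y) hle ∘ₗ
      (g.quotKerEquivOfSurjective hg).symm.toLinearMap, fun x => ?_⟩
    have : (g.quotKerEquivOfSurjective hg).symm (g x) = Submodule.Quotient.mk x := by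
      rw [LinearEquiv.symm_apply_eq]; rfl
    rw [LinearMap.comp_apply, LinearEquiv.coe_coe, this, Submodule.liftQ_apply]
  refine le_antisymm (sSup_le ?_) ?_
  · rintro n ⟨m, ⟨x, y, h⟩, rfl⟩
    obtain ⟨G, hG⟩ := key m y
    rw [← length_pi_residueField (S := S)]
    refine Module.length_le_of_surjective G fun v => ?_
    obtain ⟨x, rfl⟩ := evalPairing_surjective P h v
    exact ⟨g x, hG x⟩
  -- For a dual pair of maximal size the evaluation map is injective on Z; without a bound the
  -- supremum is infinite.
  by_cases hb : BddAbove {m : ℕ | HasDualPair P m}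
  · have hne : {m : ℕ | HasDualPair P m}.Nonempty :=
      ⟨0, Fin.elim0, Fin.elim0, fun i => i.elim0⟩
    set m := sSup {m : ℕ | HasDualPair P m}
    obtain ⟨x, y, h⟩ : HasDualPair P m := Nat.sSup_mem hne hb
    refine le_trans ?_ (le_sSup ⟨m, ⟨x, y, h⟩, rfl⟩)
    obtain ⟨G, hG⟩ := key m y
    rw [← length_pi_residueField (S := S)]
    refine Module.length_le_of_injective G ?_
    rw [injective_iff_map_eq_zero]
    intro z hz
    obtain ⟨a, rfl⟩ := hg z
    rw [hG] at hz
    rw [hP]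
    by_contra! hc
    obtain ⟨b, hb0⟩ := hc
    have ha : ∀ j, P a (y j) = 0 := fun j => congrFun hz j
    obtain ⟨u, hu⟩ := residue_surjective (P a b)⁻¹
    choose w hw using fun i => residue_surjective (P (x i) (u • b))
    have hub : P a (u • b) = 1 := by
      rw [map_smul, Algebra.smul_def]
      change residue S u * _ = 1
      rw [hu, inv_mul_cancel₀ hb0]
    have hsm : ∀ (s : S) (t : ResidueField S), s • t = residue S s * t :=
      fun s t => Algebra.smul_def s t
    -- Gram–Schmidt: a is orthogonal to every y j, and subtracting ∑ P (x i) (u • b) y i from u • b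
    -- makes it orthogonal to every x i without changing its value 1 against a.
    have hbig : HasDualPair P (m + 1) := by
      refine ⟨Fin.cons a x, Fin.cons (u • b - ∑ i, w i • y i) y, fun i j => ?_⟩
      refine Fin.cases ?_ (fun i => ?_) i <;> refine Fin.cases ?_ (fun j => ?_) j
      · rw [Fin.cons_zero, Fin.cons_zero, map_sub, hub, map_sum]
        simp [ha]
      · rw [Fin.cons_zero, Fin.cons_succ, ha, if_neg (Fin.succ_ne_zero j).symm]
      · rw [Fin.cons_zero, Fin.cons_succ, map_sub, map_sum, if_neg (Fin.succ_ne_zero i)]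
        simp only [map_smul, h, hsm, ← hw]
        simp
      · rw [Fin.cons_succ, Fin.cons_succ, h]
        simp only [Fin.succ_inj]
    have := le_csSup hb hbig
    change m + 1 ≤ m at this
    omega
  · have : sSup {n : ℕ∞ | ∃ m : ℕ, HasDualPair P m ∧ n = m} = ⊤ := by
      rw [ENat.eq_top_iff_forall_ge]
      intro m
      rw [not_bddAbove_iff] at hb
      obtain ⟨k, hk, hmk⟩ := hb m
      exact le_trans (by exact_mod_cast hmk.le) (le_sSup ⟨k, hk, rfl⟩)
    rw [this]
    exact le_top

end Pairing

/-! ### Splitting numbers through dual systems -/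

namespace GradedCartierSubring

variable {p : ℕ} {R : Type*} [CommRing R] [IsLocalRing R] [Fact p.Prime] [CharP R p]

/-- There are `n` maps in `D_e` and `n` elements of `F^e_* R` that are dual to each other modulo
the maximal ideal. -/
def HasDualSystem (D : GradedCartierSubring p R) (e n : ℕ) : Prop :=
  ∃ φ : Fin n → CartierMap p e R, (∀ i, φ i ∈ D.deg e) ∧ ∃ m : Fin n → R,
    ∀ i j, residue R (φ i (FPush.of p e (m j))) = if i = j then 1 else 0

theorem hasDualSystem_of_isInternal (D : GradedCartierSubring p R) {e k : ℕ}
    (M : Fin k → Submodule R (FPush p e R)) (s : Finset (Fin k))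
    (hs : ∀ j ∈ s, D.IsDSummand e M j) : D.HasDualSystem e s.card := by
  let ε := s.equivFin.symm
  choose θ φ hφ h1 h2 using fun i : Fin s.card => hs (ε i) (ε i).2
  refine ⟨φ, hφ, fun j => (FPush.of p e).symm ((θ j).symm 1), fun i j => ?_⟩
  rw [AddEquiv.apply_symm_apply]
  split_ifs with hij
  · subst hij
    rw [h1, LinearEquiv.apply_symm_apply, map_one]
  · rw [h2 i (ε j) (fun h => hij (ε.injective (Subtype.ext h)).symm) _ (Subtype.mem _), map_zero]

/-- A system that is dual modulo the maximal ideal can be corrected to a dual system. -/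
theorem HasDualSystem.exists_dual {D : GradedCartierSubring p R} {e n : ℕ}
    (h : D.HasDualSystem e n) : ∃ φ : Fin n → CartierMap p e R, (∀ i, φ i ∈ D.deg e) ∧
      ∃ m : Fin n → FPush p e R, ∀ i j, φ i (m j) = if i = j then 1 else 0 := by
  obtain ⟨φ, hφ, m, h⟩ := h
  -- This matrix is the identity modulo m, hence invertible; replacing the maps by their
  -- combinations with coefficients in the inverse stays inside D_e.
  let A : Matrix (Fin n) (Fin n) R := Matrix.of fun i j => φ i (FPush.of p e (m j))
  have hA : IsUnit A.det := by
    refine isUnit_of_map_unit (residue R) _ ?_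
    have : (residue R).mapMatrix A = 1 := by
      ext i j
      rw [RingHom.mapMatrix_apply, Matrix.map_apply, Matrix.one_apply]
      exact h i j
    rw [RingHom.map_det, this, Matrix.det_one]
    exact isUnit_one
  refine ⟨fun i => ∑ k, A⁻¹ i k • φ k,
    fun i => Submodule.sum_mem _ fun k _ => Submodule.smul_mem _ _ (hφ k),
    fun j => FPush.of p e (m j), fun i j => ?_⟩
  have h1 := congrFun (congrFun (Matrix.nonsing_inv_mul A hA) i) j
  rw [Matrix.mul_apply, Matrix.one_apply] at h1
  rw [← h1]
  simp [A]

theorem HasDualSystem.exists_isInternal {D : GradedCartierSubring p R} {e n : ℕ}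
    (h : D.HasDualSystem e n) : ∃ (k : ℕ) (M : Fin k → Submodule R (FPush p e R))
      (s : Finset (Fin k)), DirectSum.IsInternal M ∧ (∀ j ∈ s, D.IsDSummand e M j) ∧
        n = s.card := by
  classical
  obtain ⟨φ, hφ, m, h⟩ := h.exists_dual
  -- Index 0 carries the common kernel of the maps; the remaining summands are the lines through the
  -- dual elements.
  let M : Fin (n + 1) → Submodule R (FPush p e R) :=
    Fin.cons (⨅ i, LinearMap.ker (φ i)) fun j => Submodule.span R {m j}
  have hker : ∀ (i : Fin n) (l : Fin (n + 1)), l ≠ i.succ → ∀ x ∈ M l, φ i x = 0 := by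
    intro i l
    refine Fin.cases (fun _ x hx => ?_) (fun l hl x hx => ?_) l
    · exact (Submodule.mem_iInf _).1 hx i
    · obtain ⟨r, rfl⟩ := Submodule.mem_span_singleton.1 hx
      rw [map_smul, h, if_neg (fun hil => hl (by rw [hil])), smul_zero]
  have hspan : ∀ (i : Fin n), ∀ x ∈ M i.succ, x = φ i x • m i := by
    intro i x hx
    obtain ⟨r, rfl⟩ := Submodule.mem_span_singleton.1 hx
    rw [map_smul, h, if_pos rfl, smul_eq_mul, mul_one]
  refine ⟨n + 1, M, Finset.univ.map (Fin.succEmb n), ?_, ?_, by simp⟩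
  · constructor
    · rw [injective_iff_map_eq_zero]
      intro x hx
      have hsum : ∑ l, (x l : FPush p e R) = 0 := by
        rw [← hx, DirectSum.coeAddMonoidHom_eq_dfinsuppSum,
          DFinsupp.sum_eq_sum_fintype _ (fun _ => rfl)]
        rfl
      have hsucc : ∀ i : Fin n, (x i.succ : FPush p e R) = 0 := by
        intro i
        have h1 := congrArg (φ i) hsum
        rw [map_sum, map_zero, Finset.sum_eq_single i.succ
          (fun l _ hl => hker i l hl _ (Subtype.mem _)) (by simp)] at h1
        rw [hspan i _ (Subtype.mem _), h1, zero_smul]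
      have hzero : (x 0 : FPush p e R) = 0 := by
        rw [Fin.sum_univ_succ, Finset.sum_eq_zero fun i _ => hsucc i, add_zero] at hsum
        exact hsum
      refine DFinsupp.ext fun l => Subtype.ext ?_
      exact Fin.cases hzero hsucc l
    · intro y
      have h0 : y - ∑ i, φ i y • m i ∈ M 0 := by
        refine (Submodule.mem_iInf _).2 fun i => ?_
        rw [LinearMap.mem_ker, map_sub, map_sum]
        simp [h]
      refine ⟨DirectSum.of (fun l => M l) 0 ⟨_, h0⟩ +
        ∑ i : Fin n, DirectSum.of (fun l => M l) i.succ
        ⟨φ i y • m i, Submodule.smul_mem _ _ (Submodule.mem_span_singleton_self _)⟩, ?_⟩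
      rw [map_add, map_sum, DirectSum.coeAddMonoidHom_of]
      simp only [DirectSum.coeAddMonoidHom_of]
      exact sub_add_cancel _ _
  · intro j hj
    obtain ⟨i, -, rfl⟩ := Finset.mem_map.1 hj
    change D.IsDSummand e M i.succ
    refine ⟨LinearEquiv.ofBijective ((φ i).domRestrict (M i.succ)) ⟨?_, fun r => ?_⟩, φ i, hφ i,
      fun x => rfl, fun l hl x hx => hker i l hl x hx⟩
    · rw [injective_iff_map_eq_zero]
      intro x hx
      refine Subtype.ext ?_
      have hx' : φ i x = 0 := hx
      rw [hspan i x x.2, hx', zero_smul, Submodule.coe_zero]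
    · refine ⟨⟨r • m i, Submodule.smul_mem _ _ (Submodule.mem_span_singleton_self _)⟩, ?_⟩
      rw [LinearMap.domRestrict_apply, map_smul, h, if_pos rfl, smul_eq_mul, mul_one]

theorem splittingNumber_eq_sSup (D : GradedCartierSubring p R) (e : ℕ) :
    D.splittingNumber e = sSup {n : ℕ∞ | ∃ m : ℕ, D.HasDualSystem e m ∧ n = m} := by
  rw [splittingNumber]
  congr 1
  ext n
  constructor
  · rintro ⟨k, M, s, -, hs, rfl⟩
    exact ⟨s.card, D.hasDualSystem_of_isInternal M s hs, rfl⟩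
  · rintro ⟨m, hm, rfl⟩
    obtain ⟨k, M, s, hM, hs, rfl⟩ := hm.exists_isInternal
    exact ⟨k, M, s, hM, hs, rfl⟩

end GradedCartierSubring

/-! ### Length under restriction of scalars -/

/-- The restriction of scalars of a module along a ring endomorphism. -/
def Twist {S : Type*} [CommRing S] (_f : S →+* S) (M : Type*) : Type _ := M

namespace Twist

variable {S : Type*} [CommRing S] {f : S →+* S} {M N L : Type*} [AddCommGroup M] [Module S M]
  [AddCommGroup N] [Module S N] [AddCommGroup L] [Module S L]

instance : AddCommGroup (Twist f M) := inferInstanceAs (AddCommGroup M)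

noncomputable instance : Module S (Twist f M) := Module.compHom M f

/-- The identity of `M`, viewed as a map to the twisted module. -/
def of (f : S →+* S) : M ≃+ Twist f M := AddEquiv.refl M

theorem smul_of (r : S) (x : M) : r • of f x = of f (f r • x) := rfl

/-- Twisting is functorial. -/
noncomputable def map (f : S →+* S) (g : M →ₗ[S] N) : Twist f M →ₗ[S] Twist f N where
  toFun x := of f (g ((of f).symm x))
  map_add' x y := by simp only [map_add]
  map_smul' r x := by
    obtain ⟨x, rfl⟩ := (of f).surjective x
    rw [smul_of, AddEquiv.symm_apply_apply, AddEquiv.symm_apply_apply, map_smul, ← smul_of,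
      RingHom.id_apply]

theorem map_of (g : M →ₗ[S] N) (x : M) : map f g (of f x) = of f (g x) := rfl

theorem map_injective {g : M →ₗ[S] N} (hg : Function.Injective g) :
    Function.Injective (map f g) := hg

theorem map_surjective {g : M →ₗ[S] N} (hg : Function.Surjective g) :
    Function.Surjective (map f g) := hg

theorem map_exact {g : M →ₗ[S] N} {h : N →ₗ[S] L} (H : Function.Exact g h) :
    Function.Exact (map f g) (map f h) := H

/-- Twisting preserves isomorphisms. -/
noncomputable def congr (f : S →+* S) (g : M ≃ₗ[S] N) : Twist f M ≃ₗ[S] Twist f N :=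
  LinearEquiv.ofBijective (map f g.toLinearMap) g.bijective

/-- Every submodule remains one after twisting. This settles the infinite-length case of
`length_twist`. -/
theorem length_le_length_twist : Module.length S M ≤ Module.length S (Twist f M) := by
  let F : Submodule S M → Submodule S (Twist f M) := fun N =>
    { carrier := {x | (of f).symm x ∈ N}
      zero_mem' := N.zero_mem
      add_mem' := fun hx hy => N.add_mem hx hy
      smul_mem' := fun r _ hx => N.smul_mem (f r) hx }
  have hF : StrictMono F := fun N N' h => by
    refine lt_of_le_of_ne (fun x hx => h.le hx) fun he => h.ne (SetLike.ext fun x => ?_)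
    exact SetLike.ext_iff.1 he (of f x)
  have := Order.krullDim_le_of_strictMono F hF
  rw [← Module.coe_length, ← Module.coe_length] at this
  exact_mod_cast this

variable [IsLocalRing S]

/-- Twisting is exact and each composition factor is the residue field, so each contributes the same
length. -/
theorem length_twist (f : S →+* S) (M : Type*) [AddCommGroup M] [Module S M] :
    Module.length S (Twist f M) =
      Module.length S (Twist f (ResidueField S)) * Module.length S M := by
  by_cases hM : IsFiniteLength S M
  · induction hM with
    | @of_subsingleton M _ _ _ =>
      have : Subsingleton (Twist f M) := inferInstanceAs (Subsingleton M)
      rw [Module.length_eq_zero (M := M), Module.length_eq_zero (M := Twist f M), mul_zero]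
    | @of_simple_quotient M _ _ N _ _ ih =>
      obtain ⟨I, hI, ⟨ε⟩⟩ := isSimpleModule_iff_quot_maximal.1
        (inferInstance : IsSimpleModule S (M ⧸ N))
      obtain rfl := IsLocalRing.eq_maximalIdeal hI
      rw [Module.length_eq_add_of_exact N.subtype N.mkQ N.injective_subtype N.mkQ_surjective
          (LinearMap.exact_subtype_mkQ N),
        Module.length_eq_add_of_exact (map f N.subtype) (map f N.mkQ)
          (map_injective N.injective_subtype) (map_surjective N.mkQ_surjective)
          (map_exact (LinearMap.exact_subtype_mkQ N)), ih,
        Module.length_eq_one (R := S) (M := M ⧸ N),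
        mul_add, mul_one, (congr f ε).length_eq]
      rfl
  · have h := mt Module.length_ne_top_iff.1 hM
    rw [not_not] at h
    have h2 := length_le_length_twist (S := S) (f := f) (M := M)
    have : Nontrivial (Twist f (ResidueField S)) := inferInstanceAs (Nontrivial (ResidueField S))
    rw [h, top_le_iff] at h2
    rw [h, h2, ENat.mul_top (Module.length_pos (R := S)).ne']

theorem length_twist_comp (f g : S →+* S) :
    Module.length S (Twist (f.comp g) (ResidueField S)) =
      Module.length S (Twist g (ResidueField S)) * Module.length S (Twist f (ResidueField S)) := by
  rw [← length_twist g (Twist f (ResidueField S))]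
  let ε : Twist (f.comp g) (ResidueField S) ≃ₗ[S] Twist g (Twist f (ResidueField S)) :=
    { AddEquiv.refl (ResidueField S) with
      map_smul' := fun r x => rfl }
  exact ε.length_eq

end Twist

/-! ### The degree of Frobenius on the residue field -/

section FrobeniusDegree

/-- Submodules over `S` and over its quotient `K` coincide. This turns lengths over `S` into
dimensions over the subfield of p-th powers. -/
theorem length_eq_of_surjective_ringHom {S K M V : Type*} [CommRing S] [CommRing K]
    [AddCommGroup M] [Module S M] [AddCommGroup V] [Module K V] (σ : S →+* K)
    (hσ : Function.Surjective σ) (ε : M ≃+ V) (hε : ∀ (r : S) (x : M), ε (r • x) = σ r • ε x) :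
    (Module.Finite S M → Module.Finite K V) ∧ Module.length S M = Module.length K V := by
  let _ : Algebra S K := σ.toAlgebra
  let _ : Module S V := Module.compHom V σ
  have : IsScalarTower S K V := ⟨fun r x y => by
    rw [Algebra.smul_def, mul_smul]; rfl⟩
  let ε' : M ≃ₗ[S] V := { ε with map_smul' := hε }
  refine ⟨fun h => ?_, ?_⟩
  · have : Module.Finite S V := Module.Finite.equiv ε'
    exact Module.Finite.of_restrictScalars_finite S K V
  · rw [ε'.length_eq]
    exact Module.length_eq_of_surjective hσ

variable {p : ℕ} {S : Type*} [CommRing S] [IsLocalRing S] [Fact p.Prime] [CharP S p]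

theorem length_twist_frobenius (hF : IsFFinite p S) :
    ∃ n : ℕ, 0 < n ∧
      Module.finrank (frobenius (ResidueField S) p).fieldRange (ResidueField S) = n ∧
      Module.length S (Twist (frobenius S p) (ResidueField S)) = n := by
  have hσ : Function.Surjective
      ((frobenius (ResidueField S) p).rangeRestrictField.comp (residue S)) := by
    rintro ⟨_, y, rfl⟩
    obtain ⟨x, rfl⟩ := residue_surjective y
    exact ⟨x, rfl⟩
  -- The twisted residue field is a quotient of `F_* S`; hence [k : k^p] is finite and `finrank` is
  -- not the default value 0.
  have h1 : Module.Finite S (Twist (frobenius S p) (ResidueField S)) := by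
    have h2 : Module.Finite S (FPush p 1 S) := hF
    let g : FPush p 1 S →ₗ[S] Twist (frobenius S p) (ResidueField S) :=
      { toFun := fun x => Twist.of _ (residue S ((FPush.of p 1).symm x))
        map_add' := fun x y => by simp only [map_add]
        map_smul' := fun r x => by
          obtain ⟨x, rfl⟩ := (FPush.of p 1).surjective x
          rw [FPush.smul_of, AddEquiv.symm_apply_apply, AddEquiv.symm_apply_apply, pow_one,
            RingHom.id_apply, Twist.smul_of, map_mul, frobenius_def]
          rfl }
    exact Module.Finite.of_surjective g (residue_surjective (R := S))
  obtain ⟨h2, h3⟩ := length_eq_of_surjective_ringHom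
    (M := Twist (frobenius S p) (ResidueField S)) (V := ResidueField S) _ hσ (Twist.of _).symm
    (fun r x => by
      obtain ⟨x, rfl⟩ := (Twist.of (M := ResidueField S) (frobenius S p)).surjective x
      rw [Twist.smul_of, AddEquiv.symm_apply_apply, AddEquiv.symm_apply_apply, Algebra.smul_def,
        frobenius_def, map_pow]
      rfl)
  have h4 := h2 h1
  exact ⟨_, Module.finrank_pos, rfl, by rw [h3, Module.length_eq_finrank]⟩

theorem length_twist_iterateFrobenius (hF : IsFFinite p S) (e : ℕ) :
    ∃ n : ℕ, 0 < n ∧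
      Module.length S (Twist (iterateFrobenius S p e) (ResidueField S)) = n ∧
      (p : ℝ≥0∞) ^ ((e : ℝ) * frobAlpha p S) = n := by
  obtain ⟨n, hn, h1, h2⟩ := length_twist_frobenius hF
  refine ⟨n ^ e, pow_pos hn e, ?_, ?_⟩
  · induction e with
    | zero =>
      let ε : Twist (iterateFrobenius S p 0) (ResidueField S) ≃ₗ[S] ResidueField S :=
        { AddEquiv.refl (ResidueField S) with
          map_smul' := fun r x => by
            obtain ⟨x, rfl⟩ := (Twist.of (iterateFrobenius S p 0)).surjective x
            rw [Twist.smul_of, iterateFrobenius_zero_apply]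
            rfl }
      have : IsSimpleModule S (ResidueField S) :=
        isSimpleModule_iff_quot_maximal.2 ⟨maximalIdeal S, inferInstance, ⟨LinearEquiv.refl S _⟩⟩
      rw [ε.length_eq, Module.length_eq_one, pow_zero, Nat.cast_one]
    | succ e ih =>
      have : iterateFrobenius S p (e + 1) = (iterateFrobenius S p e).comp (frobenius S p) := by
        ext x
        rw [RingHom.comp_apply, iterateFrobenius_def, iterateFrobenius_def, frobenius_def,
          ← pow_mul, ← pow_succ']
      rw [this, Twist.length_twist_comp, ih, h2, pow_succ']
      push_cast
      rfl
  · have hp : (1 : ℝ) < p := by exact_mod_cast (Fact.out : p.Prime).one_lt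
    have hp0 : (0 : ℝ) < p := by linarith
    have h3 : (p : ℝ) ^ ((e : ℝ) * frobAlpha p S) = (n : ℝ) ^ e := by
      rw [frobAlpha, h1, mul_comm, Real.rpow_mul hp0.le, Real.rpow_logb hp0 hp.ne'
        (by exact_mod_cast hn), Real.rpow_natCast]
    have h4 : (p : ℝ≥0∞) = ENNReal.ofReal (p : ℝ) := (ENNReal.ofReal_natCast p).symm
    rw [h4, ENNReal.ofReal_rpow_of_pos hp0, h3, ← Nat.cast_pow, ENNReal.ofReal_natCast]

theorem frobAlpha_quotient (J : Ideal S) [Nontrivial (S ⧸ J)] :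
    frobAlpha p (S ⧸ J) = frobAlpha p S := by
  have hloc : IsLocalHom (Ideal.Quotient.mk J) :=
    IsLocalHom.of_surjective _ Ideal.Quotient.mk_surjective
  let σ : ResidueField S ≃+* ResidueField (S ⧸ J) :=
    RingEquiv.ofBijective (ResidueField.map (Ideal.Quotient.mk J))
      ⟨RingHom.injective _, fun x => by
        obtain ⟨x, rfl⟩ := residue_surjective x
        obtain ⟨x, rfl⟩ := Ideal.Quotient.mk_surjective x
        exact ⟨residue S x, rfl⟩⟩
  let τ : (frobenius (ResidueField S) p).fieldRange ≃+*
      (frobenius (ResidueField (S ⧸ J)) p).fieldRange :=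
    RingEquiv.ofBijective
      ((σ.toRingHom.comp (Subfield.subtype _)).codRestrict _ (by
        rintro ⟨_, x, rfl⟩
        exact ⟨σ x, (RingHom.map_frobenius σ.toRingHom p x).symm⟩))
      ⟨RingHom.injective _, by
        rintro ⟨_, x, rfl⟩
        refine ⟨⟨_, σ.symm x, rfl⟩, Subtype.ext ?_⟩
        change σ (frobenius _ p (σ.symm x)) = frobenius _ p x
        rw [frobenius_def, frobenius_def, map_pow, RingEquiv.apply_symm_apply]⟩
  rw [frobAlpha, frobAlpha, Algebra.finrank_eq_of_equiv_equiv τ σ (by ext x; rfl)]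

end FrobeniusDegree

/-! ### Factoring and lifting `p^{-e}`-linear maps -/

namespace CartierMap

variable {p e l : ℕ} {S : Type*} [CommRing S] [Fact p.Prime] [CharP S p]

theorem premul_premul (φ : CartierMap p e S) (a b : S) :
    (φ.premul a).premul b = φ.premul (a * b) := by
  ext x
  obtain ⟨x, rfl⟩ := (FPush.of p e).surjective x
  rw [premul_of, premul_of, premul_of, mul_assoc]

theorem premul_add (φ : CartierMap p e S) (a b : S) :
    φ.premul (a + b) = φ.premul a + φ.premul b := by
  ext x
  obtain ⟨x, rfl⟩ := (FPush.of p e).surjective x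
  rw [LinearMap.add_apply, premul_of, premul_of, premul_of, add_mul, map_add, map_add]

theorem premul_zero (φ : CartierMap p e S) : φ.premul 0 = 0 := by
  ext x
  obtain ⟨x, rfl⟩ := (FPush.of p e).surjective x
  rw [premul_of, zero_mul, map_zero, map_zero, LinearMap.zero_apply]

theorem premul_pow (φ : CartierMap p e S) (r a : S) :
    φ.premul (r ^ p ^ e * a) = r • φ.premul a := by
  ext x
  obtain ⟨x, rfl⟩ := (FPush.of p e).surjective x
  rw [LinearMap.smul_apply, premul_of, premul_of, mul_assoc, ← FPush.smul_of, map_smul]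

/-- If `F^l_* S` is free then the Cartier algebra satisfies `C_{e+l} = C_e · C_l`. -/
theorem exists_eq_sum_mul [Module.Free S (FPush p l S)] [Module.Finite S (FPush p l S)]
    (φ : CartierMap p (e + l) S) : ∃ (n : ℕ) (φ₁ : Fin n → CartierMap p e S)
      (φ₂ : Fin n → CartierMap p l S), φ = ∑ i, (φ₁ i).mul (φ₂ i) := by
  let u := (Module.Free.chooseBasis S (FPush p l S)).reindex (Fintype.equivFin _)
  -- Expanding x in the basis u gives x = ∑ u_i^*(x)^(p^l) u_i. Hence φ is the sum of the products
  -- of y ↦ φ(y^(p^l) u_i) with the coordinates u_i^*.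
  let φ₁ : ∀ _ : Fin (Fintype.card (Module.Free.ChooseBasisIndex S (FPush p l S))),
      CartierMap p e S := fun i =>
    { toFun := fun y => φ (FPush.of p (e + l)
        (((FPush.of p e).symm y) ^ p ^ l * (FPush.of p l).symm (u i)))
      map_add' := fun x y => by rw [map_add, add_pow_char_pow, add_mul, map_add, map_add]
      map_smul' := fun r x => by
        obtain ⟨x, rfl⟩ := (FPush.of p e).surjective x
        rw [FPush.smul_of, AddEquiv.symm_apply_apply, AddEquiv.symm_apply_apply, mul_pow,
          ← pow_mul, ← pow_add, mul_assoc, ← FPush.smul_of, map_smul, RingHom.id_apply] }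
  refine ⟨_, φ₁, fun i => u.coord i, ?_⟩
  ext x
  obtain ⟨x, rfl⟩ := (FPush.of p (e + l)).surjective x
  rw [LinearMap.sum_apply]
  have h1 : ∀ i, (φ₁ i).mul (u.coord i) (FPush.of p (e + l) x) =
      φ (FPush.of p (e + l) ((FPush.of p l).symm
        (u.repr (FPush.of p l x) i • u i))) := by
    intro i
    rw [mul_of, Module.Basis.coord_apply]
    obtain ⟨y, hy⟩ := (FPush.of p l).surjective (u i)
    change φ (FPush.of p (e + l) (_ * (FPush.of p l).symm (u i))) = _
    rw [← hy, FPush.smul_of, AddEquiv.symm_apply_apply, AddEquiv.symm_apply_apply,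
      AddEquiv.symm_apply_apply]
  simp_rw [h1]
  rw [← map_sum, ← map_sum, ← map_sum, u.sum_repr, AddEquiv.symm_apply_apply]

/-- The map `φ` on `S` induces the map `ψ` on `S ⧸ J`. -/
def Induces {J : Ideal S} [Nontrivial (S ⧸ J)] (φ : CartierMap p e S)
    (ψ : CartierMap p e (S ⧸ J)) : Prop :=
  ∀ x : S, ψ (FPush.of p e (Ideal.Quotient.mk J x)) = Ideal.Quotient.mk J (φ (FPush.of p e x))

namespace Induces

variable {J : Ideal S} [Nontrivial (S ⧸ J)]

theorem unique {φ : CartierMap p e S} {ψ ψ' : CartierMap p e (S ⧸ J)} (h : Induces φ ψ)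
    (h' : Induces φ ψ') : ψ = ψ' := by
  ext x
  obtain ⟨x, rfl⟩ := (FPush.of p e).surjective x
  obtain ⟨x, rfl⟩ := Ideal.Quotient.mk_surjective x
  rw [h x, h' x]

theorem zero : Induces (0 : CartierMap p e S) (0 : CartierMap p e (S ⧸ J)) := fun x => by
  rw [LinearMap.zero_apply, LinearMap.zero_apply, map_zero]

theorem add {φ φ' : CartierMap p e S} {ψ ψ' : CartierMap p e (S ⧸ J)} (h : Induces φ ψ)
    (h' : Induces φ' ψ') : Induces (φ + φ') (ψ + ψ') := fun x => by
  rw [LinearMap.add_apply, LinearMap.add_apply, h, h', map_add]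

theorem sum {n : ℕ} {φ : Fin n → CartierMap p e S} {ψ : Fin n → CartierMap p e (S ⧸ J)}
    (h : ∀ i, Induces (φ i) (ψ i)) : Induces (∑ i, φ i) (∑ i, ψ i) := fun x => by
  rw [LinearMap.sum_apply, LinearMap.sum_apply, map_sum]
  exact Finset.sum_congr rfl fun i _ => h i x

theorem smul {φ : CartierMap p e S} {ψ : CartierMap p e (S ⧸ J)} (h : Induces φ ψ) (r : S) :
    Induces (r • φ) (Ideal.Quotient.mk J r • ψ) := fun x => by
  rw [LinearMap.smul_apply, LinearMap.smul_apply, h, smul_eq_mul, smul_eq_mul, map_mul]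

theorem premul {φ : CartierMap p e S} {ψ : CartierMap p e (S ⧸ J)} (h : Induces φ ψ) (r : S) :
    Induces (φ.premul r) (ψ.premul (Ideal.Quotient.mk J r)) := fun x => by
  rw [premul_of, premul_of, ← map_mul, h]

theorem mul {φ : CartierMap p e S} {ψ : CartierMap p e (S ⧸ J)} {φ' : CartierMap p l S}
    {ψ' : CartierMap p l (S ⧸ J)} (hφ : Induces φ ψ) (hψ : Induces φ' ψ') :
    Induces (φ.mul φ') (ψ.mul ψ') := fun x => by
  rw [mul_of, mul_of, hψ, hφ]

/-- If `F^e_* S` is free then every `p^{-e}`-linear map on `S ⧸ J` lifts to `S`. -/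
theorem exists_lift [Module.Free S (FPush p e S)] (ψ : CartierMap p e (S ⧸ J)) :
    ∃ φ : CartierMap p e S, Induces φ ψ := by
  let g : FPush p e S →ₗ[S] S ⧸ J :=
    { toFun := fun x => ψ (FPush.of p e (Ideal.Quotient.mk J ((FPush.of p e).symm x)))
      map_add' := fun x y => by simp only [map_add]
      map_smul' := fun r x => by
        obtain ⟨x, rfl⟩ := (FPush.of p e).surjective x
        rw [FPush.smul_of, AddEquiv.symm_apply_apply, AddEquiv.symm_apply_apply, map_mul, map_pow,
          ← FPush.smul_of, map_smul]
        rfl }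
  obtain ⟨φ, hφ⟩ := Module.projective_lifting_property J.mkQ g J.mkQ_surjective
  exact ⟨φ, fun x => (LinearMap.congr_fun hφ (FPush.of p e x)).symm⟩

end Induces

end CartierMap

/-! ### The F-graded system of a Cartier subalgebra on the quotient -/

namespace CartierSubalgebra

open CartierMap

variable {p : ℕ} {S : Type*} [CommRing S] [Fact p.Prime] [CharP S p]
  {J : Ideal S} [Nontrivial (S ⧸ J)]

/-- The ideal of all `s` such that every map `φ (F^e_* s · _)` induces an element of `D_e`. -/
def liftIdeal (D : CartierSubalgebra p (S ⧸ J)) (e : ℕ) : Ideal S where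
  carrier := {s | ∀ φ : CartierMap p e S, ∃ ψ ∈ D.deg e, Induces (φ.premul s) ψ}
  zero_mem' := fun φ => ⟨0, Submodule.zero_mem _, by rw [premul_zero]; exact Induces.zero⟩
  add_mem' := fun {a b} ha hb φ => by
    obtain ⟨ψ, hψ, h⟩ := ha φ
    obtain ⟨ψ', hψ', h'⟩ := hb φ
    exact ⟨ψ + ψ', Submodule.add_mem _ hψ hψ', by rw [premul_add]; exact h.add h'⟩
  smul_mem' := fun c s hs φ => by
    obtain ⟨ψ, hψ, h⟩ := hs (φ.premul c)
    exact ⟨ψ, hψ, by rwa [premul_premul] at h⟩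

/-- Testing on a generator suffices: the other maps are its premultiples, and D_e is stable under
premultiplication. -/
theorem mem_liftIdeal_of_induces (D : CartierSubalgebra p (S ⧸ J)) {e : ℕ}
    {Φ : CartierMap p e S} (hΦ : ∀ φ, ∃ c, φ = Φ.premul c) {c : S} {ψ : CartierMap p e (S ⧸ J)}
    (hψ : ψ ∈ D.deg e) (h : Induces (Φ.premul c) ψ) : c ∈ D.liftIdeal e := by
  intro φ
  obtain ⟨t, rfl⟩ := hΦ φ
  exact ⟨ψ.premul (Ideal.Quotient.mk J t), D.premul_mem hψ _, by
    rw [premul_premul, mul_comm, ← premul_premul]; exact h.premul t⟩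

theorem liftIdeal_zero (D : CartierSubalgebra p (S ⧸ J)) : D.liftIdeal 0 = ⊤ := by
  refine (Ideal.eq_top_iff_one _).2 fun φ => ?_
  let ψ : CartierMap p 0 (S ⧸ J) :=
    { toFun := fun x => (FPush.of p 0).symm x * Ideal.Quotient.mk J (φ (FPush.of p 0 1))
      map_add' := fun x y => by rw [map_add, add_mul]
      map_smul' := fun r x => by
        obtain ⟨x, rfl⟩ := (FPush.of p 0).surjective x
        rw [FPush.smul_of, AddEquiv.symm_apply_apply, AddEquiv.symm_apply_apply, pow_zero,
          pow_one, mul_assoc, RingHom.id_apply, smul_eq_mul] }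
  refine ⟨ψ, by rw [D.deg_zero]; exact Submodule.mem_top, fun x => ?_⟩
  change Ideal.Quotient.mk J x * Ideal.Quotient.mk J (φ (FPush.of p 0 1)) = _
  have h : FPush.of p 0 (1 * x) = x • FPush.of p 0 (1 : S) := by
    rw [FPush.smul_of, pow_zero, pow_one, mul_one, one_mul]
  rw [premul_of, h, map_smul, smul_eq_mul, map_mul]

variable [IsRegularLocalRing S]

theorem exists_generator (hF : IsFFinite p S) (e : ℕ) :
    ∃ Φ : CartierMap p e S, (∀ a : S, (∀ r, Φ (FPush.of p e (a * r)) ∈ maximalIdeal S) →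
      a ∈ frobPower p (maximalIdeal S) e) ∧ ∀ φ, ∃ c, φ = Φ.premul c := by
  obtain ⟨Φ, hΦ⟩ := FPush.exists_nondegenerate hF e
  exact ⟨Φ, hΦ, FPush.exists_eq_premul hF hΦ⟩

/-- Writing φ = ∑ φ₁φ₂ gives φ(s^(p^l) t · _) = ∑ φ₁(s · φ₂(t · _)), and each factor descends to
`D`. -/
theorem liftIdeal_mul_le (hF : IsFFinite p S) (D : CartierSubalgebra p (S ⧸ J)) (e l : ℕ) :
    frobPower p (D.liftIdeal e) l * D.liftIdeal l ≤ D.liftIdeal (e + l) := by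
  have := FPush.module_finite hF l
  have := FPush.module_free hF l
  refine Ideal.mul_le.2 fun r hr t ht => ?_
  have hle : frobPower p (D.liftIdeal e) l ≤ (D.liftIdeal (e + l)).colon {t} := by
    refine Ideal.map_le_iff_le_comap.2 fun s hs => Submodule.mem_colon_singleton.2 ?_
    intro φ
    obtain ⟨n, φ₁, φ₂, rfl⟩ := φ.exists_eq_sum_mul
    choose ψ₁ hψ₁ h₁ using fun i => hs (φ₁ i)
    choose ψ₂ hψ₂ h₂ using fun i => ht (φ₂ i)
    refine ⟨∑ i, (ψ₁ i).mul (ψ₂ i), Submodule.sum_mem _ fun i _ => D.mul_mem (hψ₁ i) (hψ₂ i), ?_⟩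
    have : (∑ i, (φ₁ i).mul (φ₂ i)).premul (iterateFrobenius S p l s • t) =
        ∑ i, ((φ₁ i).premul s).mul ((φ₂ i).premul t) := by
      ext x
      obtain ⟨x, rfl⟩ := (FPush.of p (e + l)).surjective x
      rw [premul_of, LinearMap.sum_apply, LinearMap.sum_apply]
      refine Finset.sum_congr rfl fun i _ => ?_
      rw [mul_of, mul_of, premul_of, premul_of, smul_eq_mul, iterateFrobenius_def, mul_assoc,
        ← FPush.smul_of, map_smul, smul_eq_mul]
    rw [this]
    exact Induces.sum fun i => (h₁ i).mul (h₂ i)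
  exact Submodule.mem_colon_singleton.1 (hle hr)

theorem exists_liftIdeal_ne_bot (hF : IsFFinite p S) (D : CartierSubalgebra p (S ⧸ J)) :
    ∃ e, 0 < e ∧ D.liftIdeal e ≠ ⊥ := by
  obtain ⟨e, he, hne⟩ := D.exists_ne_bot
  obtain ⟨ψ, hψ, hψ0⟩ := Submodule.exists_mem_ne_zero_of_ne_bot hne
  have := FPush.module_free hF e
  obtain ⟨Φ, -, hΦ⟩ := exists_generator hF e
  obtain ⟨φ, hφ⟩ := Induces.exists_lift ψ
  obtain ⟨c, rfl⟩ := hΦ φ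
  refine ⟨e, he, fun h => hψ0 ?_⟩
  have hc := mem_liftIdeal_of_induces D hΦ hψ hφ
  rw [h, Ideal.mem_bot] at hc
  rw [hc, premul_zero] at hφ
  exact hφ.unique Induces.zero

/-- The `F`-graded system of ideals of `S` attached to a Cartier subalgebra on `S ⧸ J`. -/
def liftSystem (hF : IsFFinite p S) (D : CartierSubalgebra p (S ⧸ J)) : FGradedSystem p S where
  ideal := D.liftIdeal
  ideal_zero := D.liftIdeal_zero
  exists_ne_bot := D.exists_liftIdeal_ne_bot hF
  mul_le := D.liftIdeal_mul_le hF

theorem exists_induces_of_mem_cartier (hF : IsFFinite p S) (D : CartierSubalgebra p (S ⧸ J))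
    {e : ℕ} {φ : CartierMap p e S} (hφ : φ ∈ (D.liftSystem hF).cartier.deg e) :
    ∃ ψ ∈ D.deg e, Induces φ ψ := by
  induction hφ using Submodule.span_induction with
  | mem φ hφ =>
    obtain ⟨φ, c, hc, rfl⟩ := hφ
    exact hc φ
  | zero => exact ⟨0, Submodule.zero_mem _, Induces.zero⟩
  | add φ φ' _ _ h h' =>
    obtain ⟨ψ, hψ, h⟩ := h
    obtain ⟨ψ', hψ', h'⟩ := h'
    exact ⟨ψ + ψ', Submodule.add_mem _ hψ hψ', h.add h'⟩
  | smul r φ _ h =>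
    obtain ⟨ψ, hψ, h⟩ := h
    exact ⟨_, Submodule.smul_mem _ _ hψ, h.smul r⟩

theorem exists_mem_cartier_of_mem_deg (hF : IsFFinite p S) (D : CartierSubalgebra p (S ⧸ J))
    {e : ℕ} {ψ : CartierMap p e (S ⧸ J)} (hψ : ψ ∈ D.deg e) :
    ∃ φ ∈ (D.liftSystem hF).cartier.deg e, Induces φ ψ := by
  have := FPush.module_free hF e
  obtain ⟨Φ, -, hΦ⟩ := exists_generator hF e
  obtain ⟨φ, hφ⟩ := Induces.exists_lift ψ
  obtain ⟨c, rfl⟩ := hΦ φ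
  exact ⟨_, Submodule.subset_span ⟨Φ, c, mem_liftIdeal_of_induces D hΦ hψ hφ, rfl⟩, hφ⟩

theorem mem_deg_iff (hF : IsFFinite p S) (D : CartierSubalgebra p (S ⧸ J)) {e : ℕ}
    (ψ : CartierMap p e (S ⧸ J)) :
    ψ ∈ D.deg e ↔ ∃ φ ∈ (D.liftSystem hF).cartier.deg e, Induces φ ψ := by
  refine ⟨D.exists_mem_cartier_of_mem_deg hF, ?_⟩
  rintro ⟨φ, hφ, h⟩
  obtain ⟨ψ', hψ', h'⟩ := D.exists_induces_of_mem_cartier hF hφ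
  rwa [h.unique h']

theorem exists_cartier_ne_bot (hF : IsFFinite p S) (D : CartierSubalgebra p (S ⧸ J)) :
    ∃ e, 0 < e ∧ (D.liftSystem hF).cartier.deg e ≠ ⊥ := by
  obtain ⟨e, he, hne⟩ := D.exists_ne_bot
  obtain ⟨ψ, hψ, hψ0⟩ := Submodule.exists_mem_ne_zero_of_ne_bot hne
  obtain ⟨φ, hφ, h⟩ := D.exists_mem_cartier_of_mem_deg hF hψ
  refine ⟨e, he, fun hb => hψ0 ?_⟩
  rw [hb, Submodule.mem_bot] at hφ
  exact (hφ ▸ h).unique Induces.zero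

/-- For j in J, every functional on `F^e_* S` sends sj into J, because φ(F^e_* s · _) descends.
Freeness then puts sj into J^[p^e]. -/
theorem liftIdeal_le_colon (hF : IsFFinite p S) (D : CartierSubalgebra p (S ⧸ J)) (e : ℕ) :
    D.liftIdeal e ≤ (frobPower p J e).colon (J : Set S) := by
  have := FPush.module_finite hF e
  have := FPush.module_free hF e
  refine fun s hs => Submodule.mem_colon.2 fun j hj => ?_
  rw [← FPush.of_mem_smul_top_iff]
  refine mem_smul_top_of_forall_dual _ _ fun φ => ?_
  obtain ⟨ψ, -, h⟩ := hs φ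
  rw [← Ideal.Quotient.eq_zero_iff_mem]
  have := h j
  rw [Ideal.Quotient.eq_zero_iff_mem.2 hj, map_zero, map_zero] at this
  exact this.symm

theorem mk_mem_maximalIdeal_iff (x : S) :
    Ideal.Quotient.mk J x ∈ maximalIdeal (S ⧸ J) ↔ x ∈ maximalIdeal S := by
  have : IsLocalHom (Ideal.Quotient.mk J) := .of_surjective _ Ideal.Quotient.mk_surjective
  rw [mem_maximalIdeal, mem_maximalIdeal, mem_nonunits_iff, mem_nonunits_iff, isUnit_map_iff]

theorem residue_mk_eq_ite_iff (x : S) (P : Prop) [Decidable P] :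
    residue (S ⧸ J) (Ideal.Quotient.mk J x) = (if P then 1 else 0) ↔
      residue S x = if P then 1 else 0 := by
  have h : ∀ y : S, residue (S ⧸ J) (Ideal.Quotient.mk J y) = 0 ↔ residue S y = 0 := fun y => by
    rw [residue_eq_zero_iff, residue_eq_zero_iff, mk_mem_maximalIdeal_iff]
  split_ifs
  · have := h (x - 1)
    simpa [sub_eq_zero] using this
  · exact h x

theorem hasDualSystem_iff (hF : IsFFinite p S) (D : CartierSubalgebra p (S ⧸ J)) (e n : ℕ) :
    D.HasDualSystem e n ↔ (D.liftSystem hF).cartier.HasDualSystem e n := by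
  constructor
  · rintro ⟨ψ, hψ, m, h⟩
    choose φ hφ hi using fun i => D.exists_mem_cartier_of_mem_deg hF (hψ i)
    choose m' hm' using fun i => Ideal.Quotient.mk_surjective (m i)
    refine ⟨φ, hφ, m', fun i j => ?_⟩
    rw [← residue_mk_eq_ite_iff (J := J), ← hi, hm', h]
  · rintro ⟨φ, hφ, m, h⟩
    choose ψ hψ hi using fun i => D.exists_induces_of_mem_cartier hF (hφ i)
    refine ⟨ψ, hψ, fun i => Ideal.Quotient.mk J (m i), fun i j => ?_⟩
    rw [hi, residue_mk_eq_ite_iff, h]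

theorem splittingNumber_eq (hF : IsFFinite p S) (D : CartierSubalgebra p (S ⧸ J)) (e : ℕ) :
    D.splittingNumber e = (D.liftSystem hF).cartier.splittingNumber e := by
  simp only [GradedCartierSubring.splittingNumber_eq_sSup, D.hasDualSystem_iff hF]

theorem comap_splittingPrime (hF : IsFFinite p S) (D : CartierSubalgebra p (S ⧸ J)) :
    D.splittingPrime.comap (Ideal.Quotient.mk J) = (D.liftSystem hF).cartier.splittingPrime := by
  ext r
  constructor
  · intro h e he φ hφ
    obtain ⟨ψ, hψ, hi⟩ := D.exists_induces_of_mem_cartier hF hφ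
    rw [← mk_mem_maximalIdeal_iff (J := J), ← hi]
    exact h e he ψ hψ
  · intro h e he ψ hψ
    obtain ⟨φ, hφ, hi⟩ := D.exists_mem_cartier_of_mem_deg hF hψ
    rw [hi, mk_mem_maximalIdeal_iff]
    exact h e he φ hφ

theorem isFPure_iff (hF : IsFFinite p S) (D : CartierSubalgebra p (S ⧸ J)) :
    D.IsFPure ↔ (D.liftSystem hF).cartier.IsFPure := by
  constructor
  · rintro ⟨e, he, ψ, hψ, hs⟩
    obtain ⟨φ, hφ, hi⟩ := D.exists_mem_cartier_of_mem_deg hF hψ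
    refine ⟨e, he, φ, hφ, fun r => ?_⟩
    obtain ⟨y, hy⟩ := hs 1
    obtain ⟨y, rfl⟩ := (FPush.of p e).surjective y
    obtain ⟨y, rfl⟩ := Ideal.Quotient.mk_surjective y
    -- The value is a unit modulo J, hence in `S`; surjectivity of a linear map to `S` only needs
    -- one unit value.
    have hu : IsUnit (φ (FPush.of p e y)) := by
      have : φ (FPush.of p e y) ∉ maximalIdeal S := by
        rw [← mk_mem_maximalIdeal_iff (J := J), ← hi, hy]
        exact fun h => h isUnit_one
      simpa using this
    obtain ⟨u, hu⟩ := hu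
    exact ⟨(r * ↑u⁻¹) • FPush.of p e y, by
      rw [map_smul, ← hu, smul_eq_mul, Units.inv_mul_cancel_right]⟩
  · rintro ⟨e, he, φ, hφ, hs⟩
    obtain ⟨ψ, hψ, hi⟩ := D.exists_induces_of_mem_cartier hF hφ
    refine ⟨e, he, ψ, hψ, fun r => ?_⟩
    obtain ⟨r, rfl⟩ := Ideal.Quotient.mk_surjective r
    obtain ⟨y, rfl⟩ := hs r
    obtain ⟨y, rfl⟩ := (FPush.of p e).surjective y
    exact ⟨_, hi y⟩

theorem splittingDim_eq (hF : IsFFinite p S) (D : CartierSubalgebra p (S ⧸ J)) :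
    D.splittingDim = (D.liftSystem hF).cartier.splittingDim := by
  let g := (Ideal.Quotient.mk D.splittingPrime).comp (Ideal.Quotient.mk J)
  have hg : Function.Surjective g :=
    Ideal.Quotient.mk_surjective.comp Ideal.Quotient.mk_surjective
  have hk : RingHom.ker g = (D.liftSystem hF).cartier.splittingPrime := by
    rw [← D.comap_splittingPrime hF, ← RingHom.comap_ker, Ideal.mk_ker]
  exact (ringKrullDim_eq_of_ringEquiv ((Ideal.quotEquivOfEq hk.symm).trans
    (RingHom.quotientKerEquivOfSurjective hg))).symm

theorem isSplittingRatio_iff (hF : IsFFinite p S) (D : CartierSubalgebra p (S ⧸ J)) (r : ℝ≥0∞) :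
    D.IsSplittingRatio r ↔ (D.liftSystem hF).cartier.IsSplittingRatio r := by
  simp only [GradedCartierSubring.IsSplittingRatio, GradedCartierSubring.semigroup,
    D.splittingNumber_eq hF, D.splittingDim_eq hF, frobAlpha_quotient]

end CartierSubalgebra

/-- A dual system of size n gives a surjection of `F^e_* R` onto Rⁿ, so n is at most the number of
generators. -/
theorem GradedCartierSubring.splittingNumber_ne_top {p : ℕ} {R : Type*} [CommRing R]
    [IsLocalRing R] [Fact p.Prime] [CharP R p] (D : GradedCartierSubring p R) (e : ℕ)
    [Module.Finite R (FPush p e R)] : D.splittingNumber e ≠ ⊤ := by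
  obtain ⟨N, g, hg⟩ := Module.Finite.exists_fin' R (FPush p e R)
  have h : D.splittingNumber e ≤ N := by
    rw [D.splittingNumber_eq_sSup]
    refine sSup_le ?_
    rintro _ ⟨n, hn, rfl⟩
    obtain ⟨φ, -, m, h⟩ := hn.exists_dual
    have hs : Function.Surjective (LinearMap.pi φ) := fun v =>
      ⟨∑ j, v j • m j, funext fun i => by simp [h]⟩
    exact_mod_cast le_of_fin_surjective R (LinearMap.pi φ ∘ₗ g) (hs.comp hg)
  exact ne_top_of_le_ne_top (ENat.natCast_ne_top N) h

/-! ### Splitting numbers and splitting primes of F-graded systems -/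

namespace FGradedSystem

open CartierMap

variable {p : ℕ} {S : Type*} [CommRing S] [Fact p.Prime] [CharP S p]

/-- Sums collapse because all maps are premultiples of the same Φ; an outer scalar r enters as
r^(p^e). -/
theorem exists_eq_premul_of_mem_cartier (b : FGradedSystem p S) {e : ℕ} {Φ : CartierMap p e S}
    (hΦ : ∀ φ, ∃ c, φ = Φ.premul c) {φ : CartierMap p e S} (hφ : φ ∈ b.cartier.deg e) :
    ∃ c ∈ b.ideal e, φ = Φ.premul c := by
  induction hφ using Submodule.span_induction with
  | mem φ hφ =>
    obtain ⟨φ, c, hc, rfl⟩ := hφ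
    obtain ⟨t, rfl⟩ := hΦ φ
    exact ⟨t * c, Ideal.mul_mem_left _ _ hc, premul_premul _ _ _⟩
  | zero => exact ⟨0, Submodule.zero_mem _, (premul_zero _).symm⟩
  | add φ φ' _ _ h h' =>
    obtain ⟨c, hc, rfl⟩ := h
    obtain ⟨c', hc', rfl⟩ := h'
    exact ⟨c + c', Submodule.add_mem _ hc hc', (premul_add _ _ _).symm⟩
  | smul r φ _ h =>
    obtain ⟨c, hc, rfl⟩ := h
    exact ⟨r ^ p ^ e * c, Ideal.mul_mem_left _ _ hc, (premul_pow _ _ _).symm⟩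

theorem premul_mem_cartier (b : FGradedSystem p S) {e : ℕ} (φ : CartierMap p e S) {c : S}
    (hc : c ∈ b.ideal e) : φ.premul c ∈ b.cartier.deg e :=
  Submodule.subset_span ⟨φ, c, hc, rfl⟩

variable [IsLocalRing S]

/-- The inclusion of `F^e_* b_e` into `F^e_* S`. -/
noncomputable def idealInclusion (b : FGradedSystem p S) (e : ℕ) :
    Twist (iterateFrobenius S p e) (b.ideal e) →ₗ[S] FPush p e S where
  toFun x := FPush.of p e ((Twist.of _).symm x : b.ideal e)
  map_add' x y := by rw [map_add, Submodule.coe_add, map_add]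
  map_smul' r x := by
    obtain ⟨x, rfl⟩ := (Twist.of (iterateFrobenius S p e)).surjective x
    rw [Twist.smul_of, AddEquiv.symm_apply_apply, AddEquiv.symm_apply_apply,
      Submodule.coe_smul, smul_eq_mul, iterateFrobenius_def, RingHom.id_apply, FPush.smul_of]

/-- The pairing `(c, x) ↦ Φ (F^e_* (c x))` modulo the maximal ideal, for `c ∈ b_e`. -/
noncomputable def cartierPairing (b : FGradedSystem p S) {e : ℕ} (Φ : CartierMap p e S) :
    Twist (iterateFrobenius S p e) (b.ideal e) →ₗ[S] FPush p e S →ₗ[S] ResidueField S :=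
  ((FPush.pairing Φ).compr₂ (Algebra.linearMap S (ResidueField S))).comp (b.idealInclusion e)

theorem cartierPairing_of (b : FGradedSystem p S) {e : ℕ} (Φ : CartierMap p e S) (c : b.ideal e)
    (x : S) : b.cartierPairing Φ (Twist.of _ c) (FPush.of p e x) =
      residue S (Φ (FPush.of p e (c * x))) := rfl

theorem hasDualSystem_iff (b : FGradedSystem p S) {e : ℕ} {Φ : CartierMap p e S}
    (hΦ : ∀ φ, ∃ c, φ = Φ.premul c) (n : ℕ) :
    b.cartier.HasDualSystem e n ↔ HasDualPair (b.cartierPairing Φ) n := by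
  constructor
  · rintro ⟨φ, hφ, m, h⟩
    choose c hc hφc using fun i => b.exists_eq_premul_of_mem_cartier hΦ (hφ i)
    refine ⟨fun i => Twist.of _ ⟨c i, hc i⟩, fun j => FPush.of p e (m j), fun i j => ?_⟩
    rw [cartierPairing_of, ← h, hφc, premul_of]
  · rintro ⟨x, y, h⟩
    refine ⟨fun i => Φ.premul ((Twist.of _).symm (x i) : b.ideal e),
      fun i => b.premul_mem_cartier _ (Subtype.mem _), fun j => (FPush.of p e).symm (y j),
      fun i j => ?_⟩
    rw [premul_of, ← cartierPairing_of, AddEquiv.apply_symm_apply, AddEquiv.apply_symm_apply, h]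

theorem apply_mem_maximalIdeal {e : ℕ} (φ : CartierMap p e S) {x : S}
    (hx : x ∈ frobPower p (maximalIdeal S) e) : φ (FPush.of p e x) ∈ maximalIdeal S :=
  map_mem_of_mem_smul_top ((FPush.of_mem_smul_top_iff _ _ _).2 hx) φ

/-- The left kernel of the pairing is the part of b_e in n^[p^e], by nondegeneracy of Φ. -/
theorem splittingNumber_eq_length_ideal_quotient (b : FGradedSystem p S) {e : ℕ}
    {Φ : CartierMap p e S} (hΦ : ∀ φ, ∃ c, φ = Φ.premul c)
    (hΦ' : ∀ a : S, (∀ r, Φ (FPush.of p e (a * r)) ∈ maximalIdeal S) →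
      a ∈ frobPower p (maximalIdeal S) e) :
    b.cartier.splittingNumber e =
      Module.length S (Twist (iterateFrobenius S p e) (ResidueField S)) *
      Module.length S (b.ideal e ⧸
        (b.ideal e ⊓ frobPower p (maximalIdeal S) e).submoduleOf (b.ideal e)) := by
  rw [← Twist.length_twist, GradedCartierSubring.splittingNumber_eq_sSup]
  simp only [b.hasDualSystem_iff hΦ]
  refine sSup_hasDualPair_eq_length _ (Twist.map _ (Submodule.mkQ _))
    (Twist.map_surjective (Submodule.mkQ_surjective _)) fun x => ?_
  obtain ⟨c, rfl⟩ := (Twist.of (iterateFrobenius S p e)).surjective x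
  have h1 : Twist.map (iterateFrobenius S p e)
      (Submodule.mkQ ((b.ideal e ⊓ frobPower p (maximalIdeal S) e).submoduleOf (b.ideal e)))
      (Twist.of _ c) = 0 ↔ (c : S) ∈ frobPower p (maximalIdeal S) e := by
    rw [Twist.map_of, map_eq_zero_iff _ (Twist.of _).injective, Submodule.mkQ_apply,
      Submodule.Quotient.mk_eq_zero]
    exact ⟨fun h => h.2, fun h => ⟨c.2, h⟩⟩
  rw [h1, (FPush.of p e).surjective.forall]
  simp only [cartierPairing_of, residue_eq_zero_iff]
  exact ⟨fun h y => apply_mem_maximalIdeal Φ (Ideal.mul_mem_right _ _ h), hΦ' c⟩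

/-- The same count for the flipped pairing, whose left kernel is the colon ideal. -/
theorem splittingNumber_eq_length_quotient_colon (b : FGradedSystem p S) {e : ℕ}
    {Φ : CartierMap p e S} (hΦ : ∀ φ, ∃ c, φ = Φ.premul c)
    (hΦ' : ∀ a : S, (∀ r, Φ (FPush.of p e (a * r)) ∈ maximalIdeal S) →
      a ∈ frobPower p (maximalIdeal S) e) :
    b.cartier.splittingNumber e =
      Module.length S (Twist (iterateFrobenius S p e) (ResidueField S)) *
      Module.length S (S ⧸ (frobPower p (maximalIdeal S) e).colon (b.ideal e : Set S)) := by
  rw [← Twist.length_twist, GradedCartierSubring.splittingNumber_eq_sSup]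
  simp only [b.hasDualSystem_iff hΦ]
  simp only [← hasDualPair_flip (P := b.cartierPairing Φ)]
  let I := (frobPower p (maximalIdeal S) e).colon (b.ideal e : Set S)
  let g : FPush p e S →ₗ[S] Twist (iterateFrobenius S p e) (S ⧸ I) :=
    { toFun := fun x => Twist.of _ (Ideal.Quotient.mk I ((FPush.of p e).symm x))
      map_add' := fun x y => by simp only [map_add]
      map_smul' := fun r x => by
        obtain ⟨x, rfl⟩ := (FPush.of p e).surjective x
        rw [FPush.smul_of, AddEquiv.symm_apply_apply, AddEquiv.symm_apply_apply, RingHom.id_apply,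
          Twist.smul_of, iterateFrobenius_def]
        rfl }
  refine sSup_hasDualPair_eq_length _ g (Ideal.Quotient.mk_surjective (I := I)) fun x => ?_
  obtain ⟨x, rfl⟩ := (FPush.of p e).surjective x
  have h1 : g (FPush.of p e x) = 0 ↔ x ∈ I := Ideal.Quotient.eq_zero_iff_mem
  rw [h1, (Twist.of (iterateFrobenius S p e)).surjective.forall, Submodule.mem_colon]
  simp only [LinearMap.flip_apply, cartierPairing_of, residue_eq_zero_iff]
  constructor
  · intro h c
    rw [mul_comm]
    exact apply_mem_maximalIdeal Φ (h c c.2)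
  · intro h c hc
    refine hΦ' _ fun r => ?_
    have := h ⟨c * r, Ideal.mul_mem_right _ _ hc⟩
    rwa [mul_right_comm, mul_comm c x] at this

end FGradedSystem

theorem FGradedSystem.splittingPrime_cartier_eq {p : ℕ} {S : Type*} [CommRing S]
    [IsRegularLocalRing S] [Fact p.Prime] [CharP S p] (hF : IsFFinite p S)
    (b : FGradedSystem p S) :
    b.cartier.splittingPrime = ⨅ e : {e : ℕ // 0 < e},
      (frobPower p (maximalIdeal S) e).colon (b.ideal e : Set S) := by
  ext r
  rw [Submodule.mem_iInf]
  constructor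
  · rintro h ⟨e, he⟩
    obtain ⟨Φ, hΦ', hΦ⟩ := CartierSubalgebra.exists_generator hF e
    refine Submodule.mem_colon.2 fun c hc => hΦ' _ fun t => ?_
    have := h e he _ (b.premul_mem_cartier (Φ.premul t) hc)
    rwa [CartierMap.premul_premul, CartierMap.premul_of, mul_comm, mul_comm t, ← mul_assoc] at this
  · intro h e he φ hφ
    obtain ⟨Φ, hΦ', hΦ⟩ := CartierSubalgebra.exists_generator hF e
    obtain ⟨c, hc, rfl⟩ := b.exists_eq_premul_of_mem_cartier hΦ hφ
    rw [CartierMap.premul_of, mul_comm]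
    exact apply_mem_maximalIdeal Φ (Submodule.mem_colon.1 (h ⟨e, he⟩) c hc)

/-! ### The main theorem -/

theorem theorem4p9 {S : Type*} [CommRing S] [IsRegularLocalRing S] (p : ℕ) [Fact p.Prime]
    [CharP S p] (hF : IsFFinite p S) (J : Ideal S) [Nontrivial (S ⧸ J)]
    (D : CartierSubalgebra p (S ⧸ J)) :
    ∃ b : FGradedSystem p S,
      -- the graded Cartier algebra of `b` is a Cartier subalgebra on `S`, and it induces `D`
      (∃ e, 0 < e ∧ b.cartier.deg e ≠ ⊥) ∧
      (∀ (e : ℕ) (ψ : CartierMap p e (S ⧸ J)), ψ ∈ D.deg e ↔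
        ∃ φ ∈ b.cartier.deg e, ∀ x : S,
          ψ (FPush.of p e (Ideal.Quotient.mk J x)) =
            Ideal.Quotient.mk J (φ (FPush.of p e x))) ∧
      -- the containment and the splitting numbers
      (∀ e : ℕ, 0 < e →
        b.ideal e ≤ (frobPower p J e).colon (J : Set S) ∧
        D.splittingNumber e ≠ ⊤ ∧ b.cartier.splittingNumber e ≠ ⊤ ∧
        (D.splittingNumber e : ℝ≥0∞) / (p : ℝ≥0∞) ^ ((e : ℝ) * frobAlpha p (S ⧸ J)) =
          (b.cartier.splittingNumber e : ℝ≥0∞) / (p : ℝ≥0∞) ^ ((e : ℝ) * frobAlpha p S) ∧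
        (b.cartier.splittingNumber e : ℝ≥0∞) / (p : ℝ≥0∞) ^ ((e : ℝ) * frobAlpha p S) =
          (Module.length S
            (S ⧸ (frobPower p (maximalIdeal S) e).colon (b.ideal e : Set S)) : ℝ≥0∞) ∧
        Module.length S (S ⧸ (frobPower p (maximalIdeal S) e).colon (b.ideal e : Set S)) =
          Module.length S (b.ideal e ⧸
            (b.ideal e ⊓ frobPower p (maximalIdeal S) e).submoduleOf (b.ideal e))) ∧
      -- the splitting prime
      D.splittingPrime = b.cartier.splittingPrime.map (Ideal.Quotient.mk J) ∧
      b.cartier.splittingPrime =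
        ⨅ e : {e : ℕ // 0 < e},
          (frobPower p (maximalIdeal S) e).colon (b.ideal e : Set S) ∧
      -- the splitting dimension and the splitting ratio
      (D.IsFPure ↔ b.cartier.IsFPure) ∧
      (D.IsFPure → D.splittingDim = b.cartier.splittingDim ∧
        ∀ r : ℝ≥0∞, D.IsSplittingRatio r ↔ b.cartier.IsSplittingRatio r) := by
  refine ⟨D.liftSystem hF, D.exists_cartier_ne_bot hF, fun e ψ => D.mem_deg_iff hF ψ,
    fun e _ => ?_, ?_, FGradedSystem.splittingPrime_cartier_eq hF _, D.isFPure_iff hF,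
    fun _ => ⟨D.splittingDim_eq hF, D.isSplittingRatio_iff hF⟩⟩
  · have := FPush.module_finite hF e
    have htop := (D.liftSystem hF).cartier.splittingNumber_ne_top e
    obtain ⟨Φ, hΦ', hΦ⟩ := CartierSubalgebra.exists_generator hF e
    obtain ⟨n, hn, hlen, hpow⟩ := length_twist_iterateFrobenius hF e
    have h1 := (D.liftSystem hF).splittingNumber_eq_length_quotient_colon hΦ hΦ'
    have h2 := (D.liftSystem hF).splittingNumber_eq_length_ideal_quotient hΦ hΦ'
    rw [hlen] at h1 h2
    have hn0 : (n : ℕ∞) ≠ 0 := by exact_mod_cast hn.ne'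
    refine ⟨D.liftIdeal_le_colon hF e, by rwa [D.splittingNumber_eq hF], htop, ?_, ?_, ?_⟩
    · rw [D.splittingNumber_eq hF, frobAlpha_quotient]
    · rw [h1, hpow, ENat.toENNReal_mul, ENat.toENNReal_coe, mul_comm]
      exact ENNReal.mul_div_cancel_right (by exact_mod_cast hn.ne') (ENNReal.natCast_ne_top n)
    -- Both lengths become the splitting number after multiplication by n, which cancels in `ℕ∞`
    -- since it is finite and nonzero.
    · exact (ENat.mul_right_strictMono hn0 (ENat.natCast_ne_top n)).injective (h1.symm.trans h2)
  · rw [← D.comap_splittingPrime hF, Ideal.map_comap_of_surjective _ Ideal.Quotient.mk_surjective]
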